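/- For $\nu,\mu\in\mathbb C$ and $x\in(-1,1)$ let $$\mathsf P_\nu^{-\mu}(x)=\Big(\frac{1-x}{1+x}\Big)^{\mu/2}\frac{1}{\Gamma(\mu+1)}\,{}_2F_1\Big(-\nu,\nu+1;\mu+1;\frac{1-x}2\Big)$$ be the Ferrers function of the first kind, where ${}_2F_1(a,b;c;z)/\Gamma(c)=\sum_{k\ge0}\frac{(a)_k(b)_k}{\Gamma(c+k)}\frac{z^k}{k!}$ for $|z|<1$ (with $1/\Gamma=0$ at the poles of $\Gamma$) and by analytic continuation on $\mathbb C\setminus[1,\infty)$. For $\nu\in\mathbb C\setminus\{-1,-2,\dots\}$ and $z\in\mathbb C\setminus(-\infty,1]$ let $$Q_\nu(z)=\frac{\sqrt\pi\,\Gamma(\nu+1)}{2^{\nu+1}\,\Gamma(\nu+\frac32)\,z^{\nu+1}}\,{}_2F_1\Big(\frac{\nu+1}2,\frac{\nu+2}2;\nu+\frac32;\frac1{z^2}\Big)$$ be the Legendre function of the second kind. All powers are principal. Theorem. Let $\lambda\in\mathbb C$ with $\lambda+\frac12\notin\{0,-1,-2,\dots\}$ (so that $Q_{\lambda-1/2}$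 is defined), let $\theta,\theta'\in(0,\pi)$, and let $t\in\mathbb C$ with $|t|<1$. For $t\neq0$ put $$\chi=\frac{1+t^2-2t\cos\theta\cos\theta'}{2t\sin\theta\sin\theta'} .$$ Then the series on the left below converges absolutely. If $t\notin(-1,0]$, then $\chi\notin(-\infty,1]$ and $$\sum_{n=0}^\infty\frac{(2\lambda+1)_n\,t^n}{n!}\,\mathsf P_{n+\lambda}^{-\lambda}(\cos\theta)\,\mathsf P_{n+\lambda}^{-\lambda}(\cos\theta')=\frac{Q_{\lambda-\frac12}(\chi)}{\pi\,\Gamma(2\lambda+1)\,t^{\lambda+\frac12}\sqrt{\sin\theta\sin\theta'}},$$ with $1/\Gamma(2\lambda+1)=0$ if $\lambda$ is a negative integer. If $t\in(-1,0]$, where the right-hand side is singular or on its branch cut, the identity holds with the right-hand side replaced by its limit at $t$ taken over $\mathbb C\setminus(-\infty,0]$; in particular this limit exists. -/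

import Mathlib

open Complex Topology Filter

/-- The coefficientwise regularized Gauss hypergeometric series
`∑ (a)_k (b)_k / Γ(c + k) * z ^ k / k!`, which is `₂F₁(a, b; c; z) / Γ(c)` if `c` is not a
non-positive integer. Since `Complex.Gamma` vanishes at its poles, `(Gamma (c + k))⁻¹` is the
entire reciprocal gamma function, so the series is the right one for every complex `c`. -/
noncomputable def regHypSeries (a b c z : ℂ) : ℂ :=
  ∑' k : ℕ, (ascPochhammer ℂ k).eval a * (ascPochhammer ℂ k).eval b * (Gamma (c + k))⁻¹ *
    (z ^ k / (k.factorial : ℂ))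

/-- `f` is the principal branch of the regularized Gauss hypergeometric function: it is
holomorphic on `ℂ ∖ [1, ∞)` and is the sum of the series on the open unit disc. By the identity
theorem these two properties determine `f` on `ℂ ∖ [1, ∞)`. -/
def IsRegHypBranch (a b c : ℂ) (f : ℂ → ℂ) : Prop :=
  DifferentiableOn ℂ f {z : ℂ | 1 - z ∈ slitPlane} ∧
    ∀ z : ℂ, ‖z‖ < 1 → f z = regHypSeries a b c z

open Classical in
/-- The regularized Gauss hypergeometric function `₂F₁(a, b; c; z) / Γ(c)`: the sum of the series
for `‖z‖ < 1`, and its analytic continuation elsewhere on `ℂ ∖ [1, ∞)`. -/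
noncomputable def regHyp (a b c z : ℂ) : ℂ :=
  if ‖z‖ < 1 then regHypSeries a b c z
  else if h : ∃ f : ℂ → ℂ, IsRegHypBranch a b c f then h.choose z
  else 0

/-- The Ferrers function of the first kind of degree `ν` and order `μ` on `(-1, 1)`:
`P_ν^μ(x) = ((1 - x) / (1 + x)) ^ (-μ / 2) * ₂F₁(-ν, ν + 1; 1 - μ; (1 - x) / 2) / Γ(1 - μ)`. -/
noncomputable def ferrersP (ν μ : ℂ) (x : ℝ) : ℂ :=
  (((1 - x) / (1 + x) : ℝ) : ℂ) ^ (-μ / 2) *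
    regHyp (-ν) (ν + 1) (1 - μ) (((1 - x) / 2 : ℝ) : ℂ)

/-- Olver's normalized Legendre function of the second kind (order zero) on `ℂ ∖ (-∞, 1]`. -/
noncomputable def olverQ (ν z : ℂ) : ℂ :=
  (Real.sqrt Real.pi : ℂ) / ((2 : ℂ) ^ (ν + 1) * z ^ (ν + 1)) *
    regHyp ((ν + 1) / 2) ((ν + 2) / 2) (ν + 3 / 2) (1 / z ^ 2)

/-- The Legendre function of the second kind `Q_ν(z) = Γ(ν + 1) * olverQ ν z` on
`ℂ ∖ (-∞, 1]`, for `ν` not a negative integer. -/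
noncomputable def legendreQ (ν z : ℂ) : ℂ :=
  Gamma (ν + 1) * olverQ ν z

/-- `χ = (1 + t² - 2 t cos θ cos θ') / (2 t sin θ sin θ')`. -/
noncomputable def poissonChi (θ θ' : ℝ) (t : ℂ) : ℂ :=
  (1 + t ^ 2 - 2 * t * (Real.cos θ : ℂ) * (Real.cos θ' : ℂ)) /
    (2 * t * (Real.sin θ : ℂ) * (Real.sin θ' : ℂ))

/-- The `n`-th term `(2 lam + 1)_n t^n / n! * P_{n+lam}^{-lam}(cos θ) P_{n+lam}^{-lam}(cos θ')`. -/
noncomputable def poissonTerm (lam : ℂ) (θ θ' : ℝ) (t : ℂ) (n : ℕ) : ℂ :=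
  (ascPochhammer ℂ n).eval (2 * lam + 1) * t ^ n / (n.factorial : ℂ) *
    ferrersP (n + lam) (-lam) (Real.cos θ) * ferrersP (n + lam) (-lam) (Real.cos θ')

/-- The closed form `Q_{lam - 1/2}(χ) / (π Γ(2 lam + 1) t^{lam + 1/2} √(sin θ sin θ'))`. At a pole
of `Γ(2 lam + 1)` the value is `0`, in accordance with `1 / Γ = 0` there. -/
noncomputable def poissonClosedForm (lam : ℂ) (θ θ' : ℝ) (t : ℂ) : ℂ :=
  legendreQ (lam - 1 / 2) (poissonChi θ θ' t) /
    ((Real.pi : ℂ) * Gamma (2 * lam + 1) * t ^ (lam + 1 / 2) *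
      (Real.sqrt (Real.sin θ * Real.sin θ') : ℂ))

/-! Put β = λ + 1/2, x = cos θ, y = cos θ', v = (1 - x²)(1 - y²), D = 1 + t² - 2txy, and let C_n^β
be the Gegenbauer polynomials. Euler's transformation turns P_{n+λ}^{-λ}(x) into (sin θ / 2)^λ /
Γ(λ+1) times C_n^β(x) / C_n^β(1), where C_n^β(1) = (2λ+1)_n / n! (`ferrersP_eq_gegenbauer`). Up to a
constant the series is therefore Σ C_n^β(x) C_n^β(y) / C_n^β(1) t^n.

The product formula `gegenbauer_eval_mul_eval` rewrites the n-th coefficient as Σ_k (β)_{2k} /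
((β+1/2)_k k!) v^k C_{n-2k}^{β+2k}(xy). Summing along n - 2k with the generating function D^{-β-2k},
then over k, gives D^{-β} ₂F₁(β/2, (β+1)/2; β+1/2; 4vt²/D²). Since 4vt²/D² = 1/χ², this is
Q_{λ-1/2}(χ) up to elementary factors.

The rearrangement is carried out only for small t. The closed form continues holomorphically to the
unit disc because 1/χ² never meets [1, ∞) there (`one_sub_poisson_mem_slitPlane`), so its Taylor
series converges to it on the disc; continuity on the disc also gives the limits at t in (-1, 0].
The required branch of ₂F₁ is built from a quadratic transformation, which is itself the kernel
identity at θ = θ' = π/2 (`isRegHypBranch_quadraticBranch`). If λ is a negative integer, both sides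
vanish termwise. -/

/-! ### Binomial series -/

/-- The coefficients `(a)_n / n!` of the binomial series `(1 - z) ^ (-a)`. -/
noncomputable def binomCoeff {K : Type*} [Field K] (a : K) (n : ℕ) : K :=
  (ascPochhammer K n).eval a / (n.factorial : K)

@[simp] lemma binomCoeff_zero {K : Type*} [Field K] (a : K) : binomCoeff a 0 = 1 := by
  simp [binomCoeff]

lemma binomCoeff_succ {K : Type*} [Field K] [CharZero K] (a : K) (n : ℕ) :
    ((n : K) + 1) * binomCoeff a (n + 1) = (a + n) * binomCoeff a n := by
  have h1 : ((n : K) + 1) ≠ 0 := Nat.cast_add_one_ne_zero n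
  have h2 : (n.factorial : K) ≠ 0 := by exact_mod_cast n.factorial_ne_zero
  simp only [binomCoeff, ascPochhammer_succ_eval, Nat.factorial_succ]
  push_cast
  field_simp

lemma binomCoeff_eq_choose {K : Type*} [Field K] [CharZero K] (a : K) (n : ℕ) :
    Ring.choose (a + n - 1) n = binomCoeff a n := by
  have h2 : (n.factorial : K) ≠ 0 := by exact_mod_cast n.factorial_ne_zero
  have h := Ring.factorial_nsmul_multichoose_eq_ascPochhammer a n
  rw [Polynomial.ascPochhammer_smeval_eq_eval, nsmul_eq_mul] at h
  rw [binomCoeff, eq_div_iff h2, ← h, Ring.choose]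
  ring_nf

lemma hasSum_binomCoeff (a : ℂ) {z : ℂ} (hz : ‖z‖ < 1) :
    HasSum (fun n => binomCoeff a n * z ^ n) ((1 - z) ^ (-a)) := by
  have h := (one_div_one_sub_cpow_hasFPowerSeriesOnBall_zero a).hasSum (y := z)
    (by simpa [enorm_eq_nnnorm, ← NNReal.coe_lt_one] using hz)
  simpa [binomCoeff_eq_choose, cpow_neg, mul_comm] using h

lemma hasSum_binomCoeff_real (a : ℝ) {z : ℝ} (hz : |z| < 1) :
    HasSum (fun n => binomCoeff a n * z ^ n) ((1 - z) ^ (-a)) := by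
  have hz' : 0 ≤ 1 - z := by linarith [(abs_lt.1 hz).2]
  have h := (Real.one_div_one_sub_rpow_hasFPowerSeriesOnBall_zero a).hasSum (y := z)
    (by simpa [enorm_eq_nnnorm, ← NNReal.coe_lt_one] using hz)
  simpa [binomCoeff_eq_choose, Real.rpow_neg hz', mul_comm] using h

lemma binomCoeff_nonneg {a : ℝ} (ha : 0 ≤ a) (n : ℕ) : 0 ≤ binomCoeff a n := by
  induction n with
  | zero => simp
  | succ n ih =>
    have h := binomCoeff_succ a n
    have : (0 : ℝ) ≤ (n + 1) * binomCoeff a (n + 1) := by rw [h]; positivity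
    exact nonneg_of_mul_nonneg_right this (by positivity)

lemma norm_binomCoeff_le {a : ℂ} {b : ℝ} (hab : ‖a‖ ≤ b) (n : ℕ) :
    ‖binomCoeff a n‖ ≤ binomCoeff b n := by
  have hb : 0 ≤ b := (norm_nonneg _).trans hab
  induction n with
  | zero => simp
  | succ n ih =>
    have h1 := congrArg norm (binomCoeff_succ a n)
    have h2 := binomCoeff_succ b n
    rw [norm_mul, norm_mul] at h1
    have h3 : ‖(n : ℂ) + 1‖ = n + 1 := by
      rw [← Nat.cast_add_one, Complex.norm_natCast]; push_cast; rfl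
    have h4 : ‖a + n‖ ≤ b + n := (norm_add_le _ _).trans (by simpa using hab)
    rw [h3] at h1
    have h5 : ((n : ℝ) + 1) * ‖binomCoeff a (n + 1)‖ ≤ (n + 1) * binomCoeff b (n + 1) := by
      rw [h1, h2]
      exact mul_le_mul h4 ih (norm_nonneg _) (by positivity)
    exact le_of_mul_le_mul_left h5 (by positivity)

/-! ### Gegenbauer polynomials: recurrences and differential equation -/

/-- Gegenbauer polynomials, defined through their three-term recurrence. -/
noncomputable def gegenbauer (β : ℂ) : ℕ → Polynomial ℂ
  | 0 => 1
  | 1 => Polynomial.C (2 * β) * Polynomial.X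
  | n + 2 => Polynomial.C ((n + 2 : ℂ)⁻¹) *
      (Polynomial.C (2 * (n + 1 + β)) * Polynomial.X * gegenbauer β (n + 1) -
        Polynomial.C (n + 2 * β) * gegenbauer β n)

section
open Polynomial

lemma gegenbauer_rec (β : ℂ) (n : ℕ) :
    ((n : ℂ[X]) + 2) * gegenbauer β (n + 2) =
      2 * ((n : ℂ[X]) + 1 + C β) * X * gegenbauer β (n + 1) - ((n : ℂ[X]) + 2 * C β) * gegenbauer β n := by
  have h : (n + 2 : ℂ) ≠ 0 := by exact_mod_cast (by omega : n + 2 ≠ 0)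
  have h' : ((n : ℂ[X]) + 2) = C (n + 2 : ℂ) := by simp only [map_add, map_natCast, map_ofNat]
  rw [gegenbauer, ← mul_assoc, h', ← C_mul, mul_inv_cancel₀ h]
  simp only [map_mul, map_add, map_natCast, map_ofNat, map_one, one_mul]

/-- The two classical derivative identities need each other, so they are proved by one induction:
differentiating the three-term recurrence and inserting the first gives the second at the next
index. -/
lemma gegenbauer_derivative_aux (β : ℂ) (n : ℕ) :
    ((n : ℂ[X]) + 1) * gegenbauer β (n + 1) =
        X * derivative (gegenbauer β (n + 1)) - derivative (gegenbauer β n) ∧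
      derivative (gegenbauer β (n + 1)) =
        ((n : ℂ[X]) + 2 * C β) * gegenbauer β n + X * derivative (gegenbauer β n) := by
  induction n with
  | zero =>
    simp [gegenbauer, -map_mul]
    rw [map_mul, map_ofNat]
  | succ n ih =>
    obtain ⟨hB, hC⟩ := ih
    have hr := gegenbauer_rec β n
    have hd := congrArg derivative hr
    simp only [derivative_mul, derivative_add, derivative_sub, derivative_natCast, derivative_X,
      derivative_C, derivative_ofNat, derivative_one] at hd
    have h : ((n : ℂ[X]) + 2) ≠ 0 := by
      exact_mod_cast (by omega : n + 2 ≠ 0)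
    have hC' : derivative (gegenbauer β (n + 2)) =
        (((n + 1 : ℕ) : ℂ[X]) + 2 * C β) * gegenbauer β (n + 1) +
          X * derivative (gegenbauer β (n + 1)) := by
      apply mul_left_cancel₀ h
      push_cast
      linear_combination hd - ((n : ℂ[X]) + 2 * C β) * hB
    refine ⟨?_, hC'⟩
    have hC'' := hC'
    push_cast at hC'' ⊢
    linear_combination hr - X * hC'' + hC + X * hB

lemma gegenbauer_derivative_rec (β : ℂ) (n : ℕ) :
    ((n : ℂ[X]) + 1) * derivative (gegenbauer β (n + 2)) =
      2 * ((n : ℂ[X]) + 1 + C β) * X * derivative (gegenbauer β (n + 1)) -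
        ((n : ℂ[X]) + 1 + 2 * C β) * derivative (gegenbauer β n) := by
  have hB := (gegenbauer_derivative_aux β n).1
  have hC := (gegenbauer_derivative_aux β (n + 1)).2
  push_cast at hC
  linear_combination (n + 1) * hC + ((n : ℂ[X]) + 1 + 2 * C β) * hB

/-- By `gegenbauer_derivative_rec` the derivatives obey the three-term recurrence with parameter β +
1, so only the initial values have to match. -/
lemma derivative_gegenbauer_succ (β : ℂ) (n : ℕ) :
    derivative (gegenbauer β (n + 1)) = C (2 * β) * gegenbauer (β + 1) n := by
  induction n using Nat.twoStepInduction with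
  | zero => simp [gegenbauer]
  | one =>
    rw [(gegenbauer_derivative_aux β 1).2]
    simp only [gegenbauer, map_mul, map_add, map_one, map_ofNat, derivative_mul, derivative_C,
      derivative_X, derivative_ofNat, Nat.cast_one]
    ring
  | more n h0 h1 =>
    have h := gegenbauer_derivative_rec β (n + 1)
    have hr := gegenbauer_rec (β + 1) n
    have hn : ((n : ℂ[X]) + 2) ≠ 0 := by
      exact_mod_cast (by omega : n + 2 ≠ 0)
    apply mul_left_cancel₀ hn
    rw [h0, h1] at h
    simp only [map_add, map_one, map_mul] at *
    push_cast at h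
    linear_combination h - C 2 * C β * hr

lemma gegenbauer_ode (β : ℂ) (n : ℕ) :
    (1 - X ^ 2) * derivative (derivative (gegenbauer β n)) -
      (2 * C β + 1) * X * derivative (gegenbauer β n) + (n : ℂ[X]) * ((n : ℂ[X]) + 2 * C β) * gegenbauer β n = 0 := by
  cases n with
  | zero => simp [gegenbauer]
  | succ n =>
    obtain ⟨hB, hC⟩ := gegenbauer_derivative_aux β n
    have hD : (X ^ 2 - 1) * derivative (gegenbauer β (n + 1)) =
        ((n : ℂ[X]) + 1) * X * gegenbauer β (n + 1) - ((n : ℂ[X]) + 2 * C β) * gegenbauer β n := by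
      linear_combination -X * hB - hC
    have hd := congrArg derivative hD
    simp only [derivative_mul, derivative_add, derivative_sub, derivative_natCast, derivative_X,
      derivative_C, derivative_ofNat, derivative_one, derivative_X_pow] at hd
    push_cast at hd ⊢
    rw [show (C (2 : ℂ)) = 2 from map_ofNat C 2] at hd
    linear_combination -hd + ((n : ℂ[X]) + 2 * C β) * hB

lemma iterate_derivative_gegenbauer (β : ℂ) (k n : ℕ) :
    derivative^[k] (gegenbauer β (n + k)) =
      C (2 ^ k * (ascPochhammer ℂ k).eval β) * gegenbauer (β + k) n := by
  induction k generalizing n with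
  | zero => simp
  | succ k ih =>
    rw [Function.iterate_succ_apply', show n + (k + 1) = (n + 1) + k by ring, ih (n + 1),
      derivative_C_mul, derivative_gegenbauer_succ, ← mul_assoc, ← C_mul, ascPochhammer_succ_eval]
    congr 2
    · ring
    · push_cast; ring

end

/-! ### Generating function of the Gegenbauer polynomials as a formal power series -/

section
open PowerSeries

lemma one_sub_mul_derivative_binom (β q : ℂ) :
    (1 - C q * X) * d⁄dX ℂ (mk fun n => binomCoeff β n * q ^ n) =
      C (β * q) * mk fun n => binomCoeff β n * q ^ n := by
  ext n
  rw [sub_mul, one_mul, map_sub, mul_assoc, coeff_C_mul, coeff_C_mul, coeff_derivative, coeff_mk,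
    coeff_mk]
  have h := binomCoeff_succ β n
  cases n with
  | zero =>
    simp only [Nat.cast_zero, zero_add, pow_one, pow_zero, coeff_zero_X_mul] at h ⊢
    linear_combination q * h
  | succ n =>
    rw [coeff_succ_X_mul, coeff_derivative, coeff_mk]
    push_cast at h ⊢
    linear_combination q ^ (n + 2) * h

/-- The hypothesis is the equation (1 - 2uX + X²) F' = 2β(u - X) F of (1 - 2uX + X²)^{-β}; its
coefficients are the three-term recurrence. -/
lemma eval_gegenbauer_eq_coeff {β u : ℂ} {F : ℂ⟦X⟧} (h0 : coeff 0 F = 1)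
    (hode : d⁄dX ℂ F - C (2 * u) * (X * d⁄dX ℂ F) + X * (X * d⁄dX ℂ F) =
      C (2 * β * u) * F - C (2 * β) * (X * F)) (n : ℕ) :
    (gegenbauer β n).eval u = coeff n F := by
  have hc := fun n => congrArg (coeff n) hode
  simp only [map_add, map_sub, coeff_C_mul] at hc
  induction n using Nat.twoStepInduction with
  | zero => simp [gegenbauer, h0]
  | one =>
    have h := hc 0
    simp only [coeff_zero_X_mul, coeff_derivative] at h
    rw [h0] at h
    simp [gegenbauer]
    simp at h
    exact h.symm
  | more n i0 i1 =>
    have hn : (n + 2 : ℂ) ≠ 0 := by exact_mod_cast (by omega : n + 2 ≠ 0)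
    have h := hc (n + 1)
    have hr := congrArg (Polynomial.eval u) (gegenbauer_rec β n)
    simp at hr
    rw [i0, i1] at hr
    have e : coeff (n + 1) (X * (X * d⁄dX ℂ F)) = n * coeff n F := by
      rw [coeff_succ_X_mul]
      cases n with
      | zero => simp
      | succ n => rw [coeff_succ_X_mul, coeff_derivative]; push_cast; ring
    rw [e, coeff_succ_X_mul, coeff_succ_X_mul, coeff_derivative, coeff_derivative] at h
    apply mul_left_cancel₀ hn
    rw [hr]
    push_cast at h
    linear_combination -h

/-- With qr = 1 and 2u = q + r, 1 - 2uX + X² = (1 - qX)(1 - rX), so the generating function is a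
product of two binomial series. -/
lemma eval_gegenbauer_eq_sum (β : ℂ) {q r : ℂ} (hqr : q * r = 1) (n : ℕ) :
    (gegenbauer β n).eval ((q + r) / 2) =
      ∑ p ∈ Finset.HasAntidiagonal.antidiagonal n,
        (binomCoeff β p.1 * q ^ p.1) * (binomCoeff β p.2 * r ^ p.2) := by
  set A : ℂ⟦X⟧ := mk fun n => binomCoeff β n * q ^ n with hA
  set B : ℂ⟦X⟧ := mk fun n => binomCoeff β n * r ^ n with hB
  have hG : ∑ p ∈ Finset.HasAntidiagonal.antidiagonal n, (binomCoeff β p.1 * q ^ p.1) *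
      (binomCoeff β p.2 * r ^ p.2) = coeff n (A * B) := by
    rw [coeff_mul]; simp [hA, hB]
  have hdA := one_sub_mul_derivative_binom β q
  have hdB := one_sub_mul_derivative_binom β r
  rw [← hA] at hdA
  rw [← hB] at hdB
  have hC : (C q * C r : ℂ⟦X⟧) = 1 := by rw [← map_mul, hqr, map_one]
  rw [hG]
  refine eval_gegenbauer_eq_coeff (by simp [hA, hB]) ?_ n
  rw [Derivation.leibniz, mul_assoc 2 β, mul_left_comm 2 β, mul_div_cancel₀ _ two_ne_zero]
  simp only [smul_eq_mul, map_add, map_mul, map_ofNat] at *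
  linear_combination (1 - C r * X) * B * hdA + (1 - C q * X) * A * hdB -
      (X ^ 2 * (A * d⁄dX ℂ B + B * d⁄dX ℂ A) + 2 * C β * X * A * B) * hC
end

/-! ### Ultraspherical equation and the product formula -/

section
open Polynomial

/-- The ultraspherical differential equation `(1 - x²) q'' - 2 c x q' + N q = 0`. -/
def UltrasphericalODE (c N : ℂ) (q : ℂ[X]) : Prop :=
  (1 - X ^ 2) * derivative (derivative q) - 2 * C c * X * derivative q + C N * q = 0

lemma ultrasphericalODE_gegenbauer (β : ℂ) (n : ℕ) :
    UltrasphericalODE (β + 1 / 2) (n * (n + 2 * β)) (gegenbauer β n) := by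
  have h := gegenbauer_ode β n
  have h1 : (2 * C (β + 1 / 2) : ℂ[X]) = 2 * C β + 1 := by
    rw [← map_ofNat C 2, ← C_mul, ← C_mul, ← C_1, ← C_add]
    congr 1; ring
  have h2 : (C (n * (n + 2 * β)) : ℂ[X]) = n * ((n : ℂ[X]) + 2 * C β) := by
    simp only [map_mul, map_add, map_natCast, map_ofNat]
  rw [UltrasphericalODE, h1, h2]
  exact h

lemma UltrasphericalODE.derivative {c N : ℂ} {q : ℂ[X]} (h : UltrasphericalODE c N q) :
    UltrasphericalODE (c + 1) (N - 2 * c) (derivative q) := by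
  have hd := congrArg Polynomial.derivative h
  simp only [derivative_mul, derivative_add, derivative_sub, derivative_X, derivative_zero,
    derivative_C, derivative_ofNat, derivative_one, derivative_X_pow] at hd
  rw [UltrasphericalODE]
  have h2 : (C ((2 : ℕ) : ℂ)) = 2 := map_natCast C 2
  rw [h2] at hd
  simp only [map_sub, map_add, map_mul, map_ofNat, map_one]
  linear_combination hd

lemma UltrasphericalODE.iterate_derivative {c N : ℂ} {q : ℂ[X]} (h : UltrasphericalODE c N q)
    (j : ℕ) :
    UltrasphericalODE (c + j) (N - j * (2 * c + j - 1)) (Polynomial.derivative^[j] q) := by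
  induction j with
  | zero => simpa using h
  | succ j ih =>
    rw [Function.iterate_succ_apply']
    convert ih.derivative using 1
    · push_cast; ring
    · push_cast; ring

/-- At x = 1 the equation loses its leading term, so q(1) = 0 forces q'(1) = 0 as c ≠ 0. The
derivative solves an equation of the same kind with c + 1, so induction on the degree gives q' = 0.
-/
lemma UltrasphericalODE.eq_zero {q : ℂ[X]} {c N : ℂ} (h : UltrasphericalODE c N q)
    (hc : ∀ k : ℕ, c + k ≠ 0) (h1 : q.eval 1 = 0) : q = 0 := by
  induction hn : q.natDegree using Nat.strong_induction_on generalizing q c N with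
  | _ n ih =>
    have hd : Polynomial.derivative q = 0 := by
      rcases Nat.eq_zero_or_pos n with h0 | h0
      · exact derivative_of_natDegree_zero (hn.trans h0)
      · refine ih _ (hn ▸ natDegree_derivative_lt (by omega)) h.derivative
          (fun k => by have := hc (k + 1); push_cast at this; rwa [add_assoc, add_comm 1]) ?_ rfl
        have he := congrArg (eval 1) h
        simp [h1] at he
        rcases he with he | he
        · exact absurd he (by simpa using hc 0)
        · exact he
    rw [eq_C_of_natDegree_eq_zero (derivative_eq_zero.1 hd)] at h1 ⊢
    rw [eval_C] at h1
    rw [h1, C_0]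

lemma UltrasphericalODE.add {c N : ℂ} {p q : ℂ[X]} (hp : UltrasphericalODE c N p)
    (hq : UltrasphericalODE c N q) : UltrasphericalODE c N (p + q) := by
  rw [UltrasphericalODE] at *
  rw [derivative_add, derivative_add]
  linear_combination hp + hq

lemma UltrasphericalODE.C_mul {c N : ℂ} {p : ℂ[X]} (hp : UltrasphericalODE c N p) (a : ℂ) :
    UltrasphericalODE c N (C a * p) := by
  rw [UltrasphericalODE] at *
  rw [derivative_C_mul, derivative_C_mul]
  linear_combination C a * hp

/-- This is the equation of f^{(2k)} taken at the point yx and multiplied by (1 - x²)^k. The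
truncated exponent k - 1 is harmless at k = 0 because of the factor k. -/
lemma ultraspherical_term {c N : ℂ} {f : ℂ[X]} (hf : UltrasphericalODE c N f) (y : ℂ) (k : ℕ) :
    (1 - X ^ 2) * derivative (derivative ((1 - X ^ 2) ^ k * (derivative^[2 * k] f).comp (C y * X)))
      - 2 * C c * X * derivative ((1 - X ^ 2) ^ k * (derivative^[2 * k] f).comp (C y * X)) +
      C N * ((1 - X ^ 2) ^ k * (derivative^[2 * k] f).comp (C y * X)) =
    C (4 * k * (k + c - 1)) * ((1 - X ^ 2) ^ (k - 1) * (derivative^[2 * k] f).comp (C y * X)) -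
      C (1 - y ^ 2) * ((1 - X ^ 2) ^ k * (derivative^[2 * (k + 1)] f).comp (C y * X)) := by
  have ho := congrArg (fun p => p.comp (C y * X)) (hf.iterate_derivative (2 * k))
  simp only [add_comp, sub_comp, mul_comp, C_comp, X_comp, one_comp, zero_comp, pow_comp,
    ofNat_comp] at ho
  rw [show 2 * (k + 1) = 2 * k + 1 + 1 by ring, Function.iterate_succ_apply',
    Function.iterate_succ_apply']
  set g := derivative^[2 * k] f
  have hg : derivative (g.comp (C y * X)) = C y * (derivative g).comp (C y * X) := by
    rw [derivative_comp]; simp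
  have hg' : derivative ((derivative g).comp (C y * X)) =
      C y * (derivative (derivative g)).comp (C y * X) := by
    rw [derivative_comp]; simp
  have e4 : (C (4 : ℂ)) = 4 := map_ofNat C 4
  cases k with
  | zero =>
    simp only [pow_zero, one_mul, hg, derivative_C_mul, hg']
    simp only [CharP.cast_eq_zero, mul_zero, zero_mul, map_sub, map_pow,
      map_one, map_zero, add_zero, sub_zero] at ho ⊢
    linear_combination ho
  | succ m =>
    simp only [derivative_mul, hg, hg', derivative_pow, derivative_sub, derivative_one,
      derivative_X, derivative_C, derivative_add, derivative_zero]
    rcases m with _ | m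
    · simp at ho ⊢
      simp only [e4, map_ofNat] at *
      linear_combination (1 - X ^ 2) * ho
    · simp only [Nat.add_sub_cancel, map_sub, map_mul, map_add, map_pow, map_one, map_natCast,
        map_ofNat] at ho ⊢
      push_cast at ho ⊢
      linear_combination (1 - X ^ 2) ^ (m + 2) * ho

/-- The weights `1 / (4 ^ k (c)_k k!)` of the product formula for ultraspherical polynomials. -/
noncomputable def productWeight (c : ℂ) (k : ℕ) : ℂ :=
  (4 ^ k * (ascPochhammer ℂ k).eval c * (k.factorial : ℂ))⁻¹

lemma productWeight_succ {c : ℂ} (hc : ∀ k : ℕ, c + k ≠ 0) (k : ℕ) :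
    4 * ((k : ℂ) + 1) * (k + c) * productWeight c (k + 1) = productWeight c k := by
  have h1 : ((k : ℂ) + 1) ≠ 0 := Nat.cast_add_one_ne_zero k
  have h2 := hc k
  rw [productWeight, productWeight, ascPochhammer_succ_eval, Nat.factorial_succ, pow_succ]
  push_cast
  rw [show (4 : ℂ) ^ k * 4 * (eval c (ascPochhammer ℂ k) * (c + k)) * ((k + 1) * k.factorial) =
    (4 * ((k : ℂ) + 1) * (c + k)) * (4 ^ k * eval c (ascPochhammer ℂ k) * k.factorial) by ring,
    mul_inv, ← mul_assoc, add_comm (k : ℂ) c, mul_inv_cancel₀ (mul_ne_zero (mul_ne_zero (by norm_num) h1) h2), one_mul]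

/-- The polynomial in `x` expanding `f x * f y / f 1` for an ultraspherical polynomial `f`. -/
noncomputable def ultrasphericalProduct (c : ℂ) (f : ℂ[X]) (y : ℂ) (K : ℕ) : ℂ[X] :=
  ∑ k ∈ Finset.range K, C (productWeight c k * (1 - y ^ 2) ^ k) *
    ((1 - X ^ 2) ^ k * (derivative^[2 * k] f).comp (C y * X))

/-- The weights make the images of the summands under the operator telescope. The lower boundary
term vanishes through its factor k, the upper one through `hK`. -/
lemma ultrasphericalODE_product {c N : ℂ} {f : ℂ[X]} (hf : UltrasphericalODE c N f)
    (hc : ∀ k : ℕ, c + k ≠ 0) (y : ℂ) {K : ℕ} (hK : derivative^[2 * K] f = 0) :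
    UltrasphericalODE c N (ultrasphericalProduct c f y K) := by
  set E : ℕ → ℂ[X] := fun k => (1 - X ^ 2) ^ k * (derivative^[2 * k] f).comp (C y * X) with hE
  set T : ℕ → ℂ[X] := fun k => C (productWeight c k * (1 - y ^ 2) ^ k * (4 * k * (k + c - 1))) *
    ((1 - X ^ 2) ^ (k - 1) * (derivative^[2 * k] f).comp (C y * X)) with hT
  have key : ∀ k, C (productWeight c k * (1 - y ^ 2) ^ k) *
      ((1 - X ^ 2) * derivative (derivative (E k)) - 2 * C c * X * derivative (E k) + C N * E k) =
      T k - T (k + 1) := by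
    intro k
    have hw := productWeight_succ hc k
    rw [hE]
    simp only
    rw [ultraspherical_term hf y k, hT]
    simp only [Nat.add_sub_cancel]
    rw [mul_sub, ← mul_assoc (C _) (C _), ← C_mul, ← mul_assoc (C _) (C _), ← C_mul]
    congr 3
    rw [← hw]; push_cast; ring
  have hsum : (1 - X ^ 2) * derivative (derivative (ultrasphericalProduct c f y K)) -
      2 * C c * X * derivative (ultrasphericalProduct c f y K) +
      C N * ultrasphericalProduct c f y K = ∑ k ∈ Finset.range K, (T k - T (k + 1)) := by
    rw [ultrasphericalProduct]
    simp only [derivative_sum, derivative_C_mul, Finset.mul_sum, ← key]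
    rw [← Finset.sum_sub_distrib, ← Finset.sum_add_distrib]
    refine Finset.sum_congr rfl fun k _ => ?_
    simp only [hE]
    ring
  rw [UltrasphericalODE, hsum, Finset.sum_range_sub', hT]
  simp [hK]

/-- The product formula for polynomial solutions of the ultraspherical equation. -/
lemma UltrasphericalODE.eval_mul_eval {c N : ℂ} {f : ℂ[X]} (hf : UltrasphericalODE c N f)
    (hc : ∀ k : ℕ, c + k ≠ 0) {K : ℕ} (hK : Polynomial.derivative^[2 * K] f = 0) (x y : ℂ) :
    f.eval x * f.eval y = f.eval 1 * ∑ k ∈ Finset.range K,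
      productWeight c k * ((1 - x ^ 2) * (1 - y ^ 2)) ^ k *
        (Polynomial.derivative^[2 * k] f).eval (x * y) := by
  have hH := ultrasphericalODE_product hf hc y hK
  -- Both f(1) times the expansion and f(y) f solve the equation and agree at x = 1, hence coincide.
  have h0 : C (f.eval 1) * ultrasphericalProduct c f y K + C (-f.eval y) * f = 0 := by
    refine ((hH.C_mul _).add (hf.C_mul _)).eq_zero hc ?_
    have h1 : (ultrasphericalProduct c f y K).eval 1 = f.eval y := by
      rw [ultrasphericalProduct, eval_finsetSum]
      -- At x = 1 only the summand k = 0 survives; `K = 0` means f = 0.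
      cases K with
      | zero => simp at hK; simp [hK]
      | succ K =>
        rw [Finset.sum_range_succ']
        simp [productWeight]
    rw [eval_add, eval_mul, eval_mul, h1, eval_C, eval_C]
    ring
  have h := congrArg (eval x) h0
  simp only [eval_add, eval_mul, eval_C, ultrasphericalProduct, eval_finsetSum, eval_comp,
    eval_pow, eval_sub, eval_one, eval_X, eval_zero] at h
  rw [mul_comm (f.eval x), ← sub_eq_zero, ← neg_eq_zero, ← h]
  simp only [mul_pow, mul_comm y x]
  rw [neg_sub, sub_eq_add_neg, ← neg_mul]
  congr 2
  refine Finset.sum_congr rfl fun k _ => ?_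
  ring

lemma gegenbauer_eval_one (β : ℂ) (n : ℕ) : (gegenbauer β n).eval 1 = binomCoeff (2 * β) n := by
  induction n using Nat.twoStepInduction with
  | zero => simp [gegenbauer]
  | one => simp [gegenbauer, binomCoeff]
  | more n i0 i1 =>
    have hn : (n + 2 : ℂ) ≠ 0 := by exact_mod_cast (by omega : n + 2 ≠ 0)
    have hr := congrArg (Polynomial.eval 1) (gegenbauer_rec β n)
    simp at hr
    rw [i0, i1] at hr
    have h1 := binomCoeff_succ (2 * β) n
    have h2 := binomCoeff_succ (2 * β) (n + 1)
    push_cast at h2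
    apply mul_left_cancel₀ hn
    linear_combination hr - h2 + h1

lemma iterate_derivative_gegenbauer_eq_zero (β : ℂ) {n k : ℕ} (h : n < k) :
    derivative^[k] (gegenbauer β n) = 0 := by
  obtain ⟨j, rfl⟩ := Nat.exists_eq_add_of_lt h
  have h0 := iterate_derivative_gegenbauer β n 0
  rw [zero_add] at h0
  rw [show n + j + 1 = j + 1 + n by ring, Function.iterate_add_apply, h0,
    Function.iterate_succ_apply, derivative_C_mul]
  simp [gegenbauer]

/-- The product formula for Gegenbauer polynomials. -/
lemma gegenbauer_eval_mul_eval {β : ℂ} (hc : ∀ k : ℕ, β + 1 / 2 + k ≠ 0) (n : ℕ) (x y : ℂ) :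
    (gegenbauer β n).eval x * (gegenbauer β n).eval y =
      binomCoeff (2 * β) n * ∑ k ∈ Finset.range (n / 2 + 1),
        (ascPochhammer ℂ (2 * k)).eval β / ((ascPochhammer ℂ k).eval (β + 1 / 2) * k.factorial) *
          ((1 - x ^ 2) * (1 - y ^ 2)) ^ k *
          (gegenbauer (β + (2 * k : ℕ)) (n - 2 * k)).eval (x * y) := by
  rw [(ultrasphericalODE_gegenbauer β n).eval_mul_eval hc (K := n / 2 + 1)
    (iterate_derivative_gegenbauer_eq_zero β (by omega)), gegenbauer_eval_one]
  congr 1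
  refine Finset.sum_congr rfl fun k hk => ?_
  have hk' : 2 * k ≤ n := by have := Finset.mem_range.1 hk; omega
  obtain ⟨m, rfl⟩ := Nat.exists_eq_add_of_le' hk'
  rw [iterate_derivative_gegenbauer, Nat.add_sub_cancel, eval_mul, eval_C, productWeight]
  have h4 : (2 : ℂ) ^ (2 * k) = 4 ^ k := by rw [pow_mul]; norm_num
  have h4' : (4 : ℂ) ^ k ≠ 0 := pow_ne_zero _ (by norm_num)
  rw [h4, mul_assoc, mul_inv, div_eq_mul_inv]
  field_simp

end

/-! ### Cauchy products and Euler's transformation -/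

lemma HasSum.cauchyProduct {f g : ℕ → ℂ} {a b : ℂ} (hf : HasSum f a) (hg : HasSum g b) :
    HasSum (fun n => ∑ p ∈ Finset.HasAntidiagonal.antidiagonal n, f p.1 * g p.2) (a * b) := by
  have hf' := hf.summable.norm
  have hg' := hg.summable.norm
  rw [← hf.tsum_eq, ← hg.tsum_eq,
    tsum_mul_tsum_eq_tsum_sum_antidiagonal_of_summable_norm hf' hg']
  exact (summable_norm_sum_mul_antidiagonal_of_summable_norm hf' hg').of_norm.hasSum

lemma hasSum_coeff_mul {F G : PowerSeries ℂ} {z a b : ℂ}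
    (hF : HasSum (fun n => PowerSeries.coeff n F * z ^ n) a)
    (hG : HasSum (fun n => PowerSeries.coeff n G * z ^ n) b) :
    HasSum (fun n => PowerSeries.coeff n (F * G) * z ^ n) (a * b) := by
  convert hF.cauchyProduct hG using 2 with n
  rw [PowerSeries.coeff_mul, Finset.sum_mul]
  refine Finset.sum_congr rfl fun p hp => ?_
  rw [← Finset.HasAntidiagonal.mem_antidiagonal.1 hp, pow_add]
  ring

lemma Polynomial.hasSum_coeff_mul_pow (p : Polynomial ℂ) (z : ℂ) :
    HasSum (fun n => PowerSeries.coeff n (p : PowerSeries ℂ) * z ^ n) (p.eval z) := by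
  rw [Polynomial.eval_eq_sum_range]
  simp only [Polynomial.coeff_coe]
  refine hasSum_sum_of_ne_finset_zero fun n hn => ?_
  rw [Polynomial.coeff_eq_zero_of_natDegree_lt (by simpa using hn), zero_mul]

lemma Complex.Gamma_add_natCast_eq {c : ℂ} (hc : ∀ k : ℕ, c + k ≠ 0) (k : ℕ) :
    Gamma (c + k) = (ascPochhammer ℂ k).eval c * Gamma c := by
  induction k with
  | zero => simp
  | succ k ih =>
    rw [Nat.cast_succ, ← add_assoc, Gamma_add_one _ (hc k), ih, ascPochhammer_succ_eval]
    ring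

lemma ascPochhammer_eval_ne_zero {c : ℂ} (hc : ∀ k : ℕ, c + k ≠ 0) (k : ℕ) :
    (ascPochhammer ℂ k).eval c ≠ 0 := by
  induction k with
  | zero => simp
  | succ k ih => rw [ascPochhammer_succ_eval]; exact mul_ne_zero ih (hc k)

section
open PowerSeries

lemma coeff_X_mul_derivative (F : ℂ⟦X⟧) (n : ℕ) :
    coeff n (X * d⁄dX ℂ F) = n * coeff n F := by
  cases n with
  | zero => simp
  | succ n => rw [coeff_succ_X_mul, coeff_derivative]; push_cast; ring

/-- Power series solutions of the hypergeometric equation have hypergeometric coefficients. -/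
lemma coeff_of_hypergeometric_ode {a b c : ℂ} {F : ℂ⟦X⟧}
    (h : d⁄dX ℂ (X * d⁄dX ℂ F) + C (c - 1) * d⁄dX ℂ F =
      X * d⁄dX ℂ (X * d⁄dX ℂ F) + C (a + b) * (X * d⁄dX ℂ F) + C (a * b) * F) (k : ℕ) :
    coeff k F * ((ascPochhammer ℂ k).eval c * k.factorial) =
      coeff 0 F * ((ascPochhammer ℂ k).eval a * (ascPochhammer ℂ k).eval b) := by
  induction k with
  | zero => simp
  | succ k ih =>
    have hk := congrArg (coeff k) h
    simp only [map_add (coeff k), coeff_C_mul, coeff_derivative, coeff_X_mul_derivative] at hk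
    simp only [ascPochhammer_succ_eval, Nat.factorial_succ]
    push_cast at hk ⊢
    linear_combination ((ascPochhammer ℂ k).eval c * (k.factorial : ℂ)) * hk + (a + k) * (b + k) * ih

/-- The substitution x = 1 - 2z makes the ultraspherical equation hypergeometric, and the factor (1
- z)^λ moves its parameters to those of the Ferrers function. The equation is written with the Euler
operator z d/dz so that its coefficients form a two-term recurrence. -/
lemma hypergeometric_ode_of_ultraspherical {lam ν : ℂ} {f : Polynomial ℂ}
    (hf : UltrasphericalODE (lam + 1) (ν * (ν + 2 * lam + 1)) f) {B Q F : ℂ⟦X⟧}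
    (hB : B = mk fun n => binomCoeff (-lam) n * 1 ^ n)
    (hQ : Q = (f.comp (1 - 2 * Polynomial.X) : Polynomial ℂ)) (hF : F = B * Q) :
    d⁄dX ℂ (X * d⁄dX ℂ F) + C (lam + 1 - 1) * d⁄dX ℂ F =
      X * d⁄dX ℂ (X * d⁄dX ℂ F) + C (-(ν + lam) + (ν + lam + 1)) * (X * d⁄dX ℂ F) +
        C (-(ν + lam) * (ν + lam + 1)) * F := by
  have hB1 := one_sub_mul_derivative_binom (-lam) 1
  rw [← hB] at hB1
  have hB2 := congrArg (d⁄dX ℂ) hB1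
  have hlin : Polynomial.derivative (1 - 2 * Polynomial.X : Polynomial ℂ) = -2 := by
    simp
  have hQ2 : X * (1 - X) * d⁄dX ℂ (d⁄dX ℂ Q) + C (lam + 1) * (1 - 2 * X) * d⁄dX ℂ Q +
      C (ν * (ν + 2 * lam + 1)) * Q = 0 := by
    have ho := congrArg (fun p => p.comp (1 - 2 * Polynomial.X : Polynomial ℂ)) hf
    simp only [Polynomial.add_comp, Polynomial.sub_comp, Polynomial.mul_comp, Polynomial.C_comp,
      Polynomial.X_comp, Polynomial.one_comp, Polynomial.zero_comp, Polynomial.pow_comp,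
      Polynomial.ofNat_comp] at ho
    have h1 : Polynomial.derivative (f.comp (1 - 2 * Polynomial.X)) =
        -2 * (Polynomial.derivative f).comp (1 - 2 * Polynomial.X) := by
      rw [Polynomial.derivative_comp, hlin]
    have h2 : Polynomial.derivative (Polynomial.derivative (f.comp (1 - 2 * Polynomial.X))) =
        4 * (Polynomial.derivative (Polynomial.derivative f)).comp (1 - 2 * Polynomial.X) := by
      rw [h1, Polynomial.derivative_mul, Polynomial.derivative_comp, hlin]
      simp
      ring
    rw [hQ, derivative_coe, derivative_coe, h2, h1, ← Polynomial.coe_X, ← Polynomial.coe_C,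
      ← Polynomial.coe_C]
    have c2 : ((2 : Polynomial ℂ) : ℂ⟦X⟧) = 2 := map_ofNat Polynomial.coeToPowerSeries.ringHom 2
    have c4 : ((4 : Polynomial ℂ) : ℂ⟦X⟧) = 4 := map_ofNat Polynomial.coeToPowerSeries.ringHom 4
    have ho' := congrArg (fun p : Polynomial ℂ => (p : ℂ⟦X⟧)) ho
    simp only [Polynomial.coe_add, Polynomial.coe_sub, Polynomial.coe_mul, Polynomial.coe_pow,
      Polynomial.coe_one, Polynomial.coe_zero, Polynomial.coe_neg, Nat.cast_ofNat, c2, c4] at ho' ⊢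
    linear_combination ho'
  rw [hF]
  simp only [Derivation.leibniz, smul_eq_mul, map_sub, map_add, map_mul, map_one, map_neg,
    derivative_X, derivative_C, Derivation.map_one_eq_zero, map_ofNat] at *
  linear_combination B * hQ2 + X * Q * hB2 + (2 * X * d⁄dX ℂ Q + (C lam + 1) * Q) * hB1

/-- Euler's transformation of the hypergeometric series into a polynomial. -/
lemma regHypSeries_eq_of_ultraspherical {lam ν : ℂ} (hc : ∀ k : ℕ, lam + 1 + k ≠ 0)
    {f : Polynomial ℂ} (hf : UltrasphericalODE (lam + 1) (ν * (ν + 2 * lam + 1)) f)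
    {z : ℂ} (hz : ‖z‖ < 1) :
    f.eval 1 * (Gamma (lam + 1) * regHypSeries (-(ν + lam)) (ν + lam + 1) (lam + 1) z) =
      (1 - z) ^ lam * f.eval (1 - 2 * z) := by
  set B : ℂ⟦X⟧ := mk fun n => binomCoeff (-lam) n * 1 ^ n with hB
  set Q : ℂ⟦X⟧ := ((f.comp (1 - 2 * Polynomial.X) : Polynomial ℂ) : ℂ⟦X⟧) with hQ
  have hode := hypergeometric_ode_of_ultraspherical hf hB hQ rfl
  have hco := coeff_of_hypergeometric_ode hode
  have hsB : HasSum (fun n => coeff n B * z ^ n) ((1 - z) ^ lam) := by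
    simpa [hB] using hasSum_binomCoeff (-lam) hz
  have hsQ : HasSum (fun n => coeff n Q * z ^ n) (f.eval (1 - 2 * z)) := by
    have he := (f.comp (1 - 2 * Polynomial.X)).hasSum_coeff_mul_pow z
    rwa [Polynomial.eval_comp, Polynomial.eval_sub, Polynomial.eval_mul, Polynomial.eval_one,
      Polynomial.eval_ofNat, Polynomial.eval_X] at he
  have h0 : coeff 0 (B * Q) = f.eval 1 := by
    rw [coeff_zero_eq_constantCoeff_apply, map_mul, hB, hQ]
    simp [Polynomial.coeff_zero_eq_eval_zero, Polynomial.eval_comp]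
  rw [← (hasSum_coeff_mul hsB hsQ).tsum_eq, regHypSeries, ← tsum_mul_left, ← tsum_mul_left]
  refine tsum_congr fun k => ?_
  have hk := hco k
  rw [h0] at hk
  have hg : Gamma (lam + 1) ≠ 0 := Gamma_ne_zero fun m hm => hc m (by rw [hm]; ring)
  have hp := ascPochhammer_eval_ne_zero hc k
  have hkf : (k.factorial : ℂ) ≠ 0 := by exact_mod_cast k.factorial_ne_zero
  rw [Gamma_add_natCast_eq hc]
  field_simp
  linear_combination (-z ^ k) * hk

end

/-! ### Ferrers functions as Gegenbauer polynomials -/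

lemma Complex.ofReal_sq_cpow_half {r : ℝ} (hr : 0 < r) (a : ℂ) :
    ((r ^ 2 : ℝ) : ℂ) ^ (a / 2) = (r : ℂ) ^ a := by
  rw [cpow_def_of_ne_zero (by exact_mod_cast (pow_pos hr 2).ne'),
    cpow_def_of_ne_zero (by exact_mod_cast hr.ne'), ← ofReal_log (by positivity),
    ← ofReal_log hr.le, Real.log_pow]
  push_cast
  ring_nf

/-- For z = (1 - cos θ)/2, Euler's factor is ((1 + cos θ)/2)^λ; together with the prefactor of the
Ferrers function it gives (sin θ / 2)^λ. The binomial coefficient is C_n^β(1). -/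
lemma ferrersP_eq_gegenbauer {lam : ℂ} (hc : ∀ k : ℕ, lam + 1 + k ≠ 0) {θ : ℝ}
    (hθ : θ ∈ Set.Ioo 0 Real.pi) (n : ℕ) :
    binomCoeff (2 * lam + 1) n * ferrersP (n + lam) (-lam) (Real.cos θ) =
      ((Real.sin θ / 2 : ℝ) : ℂ) ^ lam * (Gamma (lam + 1))⁻¹ *
        (gegenbauer (lam + 1 / 2) n).eval (Real.cos θ : ℂ) := by
  have hs : 0 < Real.sin θ := Real.sin_pos_of_mem_Ioo hθ
  have hsc := Real.sin_sq_add_cos_sq θ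
  have hx1 : 0 < 1 - Real.cos θ := by nlinarith
  have hx2 : 0 < 1 + Real.cos θ := by nlinarith
  have hz : ‖(((1 - Real.cos θ) / 2 : ℝ) : ℂ)‖ < 1 := by
    rw [norm_real, Real.norm_of_nonneg (by linarith)]
    linarith
  have hg : Gamma (lam + 1) ≠ 0 := Gamma_ne_zero fun m hm => hc m (by rw [hm]; ring)
  have hf : UltrasphericalODE (lam + 1) (n * (n + 2 * lam + 1)) (gegenbauer (lam + 1 / 2) n) := by
    convert ultrasphericalODE_gegenbauer (lam + 1 / 2) n using 1 <;> ring
  have hE := regHypSeries_eq_of_ultraspherical hc hf hz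
  rw [gegenbauer_eval_one] at hE
  have e1 : (1 : ℂ) - 2 * (((1 - Real.cos θ) / 2 : ℝ) : ℂ) = (Real.cos θ : ℂ) := by
    push_cast; ring
  have e2 : (1 : ℂ) - (((1 - Real.cos θ) / 2 : ℝ) : ℂ) = (((1 + Real.cos θ) / 2 : ℝ) : ℂ) := by
    push_cast; ring
  have e3 : (((1 - Real.cos θ) / (1 + Real.cos θ) : ℝ) : ℂ) ^ (lam / 2) *
      (((1 + Real.cos θ) / 2 : ℝ) : ℂ) ^ lam = ((Real.sin θ / 2 : ℝ) : ℂ) ^ lam := by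
    rw [← ofReal_sq_cpow_half (by linarith : 0 < (1 + Real.cos θ) / 2),
      ← ofReal_sq_cpow_half (by linarith : 0 < Real.sin θ / 2),
      ← mul_cpow_ofReal_nonneg (by positivity) (by positivity), ← ofReal_mul]
    congr 2
    field_simp
    linear_combination -hsc
  rw [e1, e2] at hE
  rw [ferrersP, regHyp, neg_neg, if_pos hz, sub_neg_eq_add, add_comm 1 lam, ← e3]
  rw [show 2 * (lam + 1 / 2) = 2 * lam + 1 by ring] at hE
  have h := congrArg (fun w => (Gamma (lam + 1))⁻¹ * w) hE
  simp only [mul_left_comm _ (Gamma (lam + 1)), mul_inv_cancel_left₀ hg] at h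
  linear_combination (((1 - Real.cos θ) / (1 + Real.cos θ) : ℝ) : ℂ) ^ (lam / 2) * h

/-! ### Convergence and holomorphy of the hypergeometric series -/

lemma regHypSeries_eq_regularizedGaussHGFun (a b c z : ℂ) :
    regHypSeries a b c z = regularizedGaussHGFun a b c z := by
  rw [regHypSeries, regularizedGaussHGFun, FormalMultilinearSeries.sum]
  refine tsum_congr fun k => ?_
  rw [FormalMultilinearSeries.apply_eq_pow_smul_coeff, coeff_regularizedGaussHGFunSeries,
    smul_eq_mul]
  simp only [div_eq_mul_inv, mul_inv]
  ring

lemma hasFPowerSeriesOnBall_regHypSeries (a b c : ℂ) :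
    HasFPowerSeriesOnBall (regHypSeries a b c) (regularizedGaussHGFunSeries a b c) 0 1 := by
  have h := radius_regularizedGaussHGFunSeries_ge_one a b c
  have h' := (FormalMultilinearSeries.hasFPowerSeriesOnBall _ (one_pos.trans_le h)).mono one_pos h
  refine h'.congr fun z _ => ?_
  exact (regHypSeries_eq_regularizedGaussHGFun a b c z).symm

lemma hasSum_regHypSeries (a b c : ℂ) {z : ℂ} (hz : ‖z‖ < 1) :
    HasSum (fun k : ℕ => (ascPochhammer ℂ k).eval a * (ascPochhammer ℂ k).eval b *
      (Gamma (c + k))⁻¹ * (z ^ k / (k.factorial : ℂ))) (regHypSeries a b c z) := by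
  have h := (hasFPowerSeriesOnBall_regHypSeries a b c).hasSum (y := z)
    (by simpa [enorm_eq_nnnorm, ← NNReal.coe_lt_one] using hz)
  rw [zero_add] at h
  have e : ∀ k : ℕ, (ascPochhammer ℂ k).eval a * (ascPochhammer ℂ k).eval b *
      (Gamma (c + k))⁻¹ * (z ^ k / (k.factorial : ℂ)) =
      regularizedGaussHGFunSeries a b c k fun _ => z := by
    intro k
    rw [FormalMultilinearSeries.apply_eq_pow_smul_coeff, coeff_regularizedGaussHGFunSeries,
      smul_eq_mul]
    simp only [div_eq_mul_inv, mul_inv]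
    ring
  simpa only [e] using h

lemma differentiableOn_regHypSeries (a b c : ℂ) :
    DifferentiableOn ℂ (regHypSeries a b c) (Metric.ball 0 1) := by
  have h := (hasFPowerSeriesOnBall_regHypSeries a b c).differentiableOn
  rwa [← ENNReal.ofReal_one, Metric.eball_ofReal] at h

/-! ### The quadratic 1 + t² - 2t cos ψ and the analytic generating function -/

lemma Complex.mul_cpow_of_re_pos {a b : ℂ} (ha : 0 < a.re) (hb : 0 < b.re) (s : ℂ) :
    (a * b) ^ s = a ^ s * b ^ s := by
  have ha0 : a ≠ 0 := fun h => by simp [h] at ha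
  have hb0 : b ≠ 0 := fun h => by simp [h] at hb
  have h1 := abs_lt.1 (abs_arg_lt_pi_div_two_iff.2 (Or.inl ha))
  have h2 := abs_lt.1 (abs_arg_lt_pi_div_two_iff.2 (Or.inl hb))
  have hl : log (a * b) = log a + log b :=
    (log_mul_eq_add_log_iff ha0 hb0).2 ⟨by linarith, by linarith⟩
  rw [cpow_def_of_ne_zero (mul_ne_zero ha0 hb0), cpow_def_of_ne_zero ha0, cpow_def_of_ne_zero hb0,
    hl, add_mul, exp_add]

/-- The quadratic `1 + t² - 2 t cos ψ`. -/
noncomputable def poissonQuad (ψ : ℝ) (t : ℂ) : ℂ := 1 + t ^ 2 - 2 * t * (Real.cos ψ : ℂ)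

lemma poissonQuad_eq_mul (ψ : ℝ) (t : ℂ) :
    poissonQuad ψ t = (1 - t * exp (ψ * I)) * (1 - t * exp (-(ψ * I))) := by
  have h : exp (ψ * I) * exp (-(ψ * I)) = 1 := by rw [← exp_add]; simp
  have h2 := two_cos (ψ : ℂ)
  rw [poissonQuad, ofReal_cos]
  rw [neg_mul] at h2
  linear_combination -t * h2 - t ^ 2 * h

lemma norm_mul_exp_mul_I (ψ : ℝ) (t : ℂ) : ‖t * exp (ψ * I)‖ = ‖t‖ := by
  rw [norm_mul, norm_exp_ofReal_mul_I, mul_one]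

lemma norm_mul_exp_neg_mul_I (ψ : ℝ) (t : ℂ) : ‖t * exp (-(ψ * I))‖ = ‖t‖ := by
  have := norm_mul_exp_mul_I (-ψ) t
  rwa [ofReal_neg, neg_mul] at this

lemma one_sub_re_pos {z : ℂ} (hz : ‖z‖ < 1) : 0 < (1 - z).re := by
  have := (abs_le.1 (abs_re_le_norm z)).2
  simp; linarith

lemma poissonQuad_cpow {t : ℂ} (ht : ‖t‖ < 1) (ψ : ℝ) (s : ℂ) :
    poissonQuad ψ t ^ s = (1 - t * exp (ψ * I)) ^ s * (1 - t * exp (-(ψ * I))) ^ s := by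
  rw [poissonQuad_eq_mul]
  exact mul_cpow_of_re_pos (one_sub_re_pos (by rwa [norm_mul_exp_mul_I]))
    (one_sub_re_pos (by rwa [norm_mul_exp_neg_mul_I])) s

/-- Both factors 1 - t e^{±iψ} lie in the right half-plane, so their arguments add up to less than π
in absolute value. -/
lemma poissonQuad_mem_slitPlane {t : ℂ} (ht : ‖t‖ < 1) (ψ : ℝ) :
    poissonQuad ψ t ∈ slitPlane := by
  have ha := one_sub_re_pos (z := t * exp (ψ * I)) (by rwa [norm_mul_exp_mul_I])
  have hb := one_sub_re_pos (z := t * exp (-(ψ * I))) (by rwa [norm_mul_exp_neg_mul_I])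
  rw [poissonQuad_eq_mul]
  generalize 1 - t * exp (ψ * I) = a at *
  generalize 1 - t * exp (-(ψ * I)) = b at *
  have h1 := abs_lt.1 (abs_arg_lt_pi_div_two_iff.2 (Or.inl ha))
  have h2 := abs_lt.1 (abs_arg_lt_pi_div_two_iff.2 (Or.inl hb))
  have ha0 : a ≠ 0 := fun h => by simp [h] at ha
  have hb0 : b ≠ 0 := fun h => by simp [h] at hb
  rw [mem_slitPlane_iff_arg]
  refine ⟨?_, mul_ne_zero ha0 hb0⟩
  rw [arg_mul ha0 hb0 ⟨by linarith, by linarith⟩]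
  linarith

lemma norm_poissonQuad_ge {t : ℂ} (ht : ‖t‖ < 1) (ψ : ℝ) :
    (1 - ‖t‖) ^ 2 ≤ ‖poissonQuad ψ t‖ := by
  rw [poissonQuad_eq_mul, norm_mul, sq]
  have h1 := norm_sub_norm_le 1 (t * exp (ψ * I))
  have h2 := norm_sub_norm_le 1 (t * exp (-(ψ * I)))
  rw [norm_mul_exp_mul_I, norm_one] at h1
  rw [norm_mul_exp_neg_mul_I, norm_one] at h2
  exact mul_le_mul h1 h2 (by linarith) (norm_nonneg _)

lemma eval_gegenbauer_cos (β : ℂ) (ψ : ℝ) (n : ℕ) :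
    (gegenbauer β n).eval (Real.cos ψ : ℂ) = ∑ p ∈ Finset.HasAntidiagonal.antidiagonal n,
      (binomCoeff β p.1 * exp (ψ * I) ^ p.1) * (binomCoeff β p.2 * exp (-(ψ * I)) ^ p.2) := by
  have h : exp (ψ * I) * exp (-(ψ * I)) = 1 := by rw [← exp_add]; simp
  rw [← eval_gegenbauer_eq_sum β h, ofReal_cos, Complex.cos, neg_mul]

/-- The generating function of the Gegenbauer polynomials. -/
lemma hasSum_gegenbauer (β : ℂ) (ψ : ℝ) {t : ℂ} (ht : ‖t‖ < 1) :
    HasSum (fun n => (gegenbauer β n).eval (Real.cos ψ : ℂ) * t ^ n) (poissonQuad ψ t ^ (-β)) := by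
  rw [poissonQuad_cpow ht]
  convert (hasSum_binomCoeff β (z := t * exp (ψ * I)) (by rwa [norm_mul_exp_mul_I])).cauchyProduct
    (hasSum_binomCoeff β (z := t * exp (-(ψ * I))) (by rwa [norm_mul_exp_neg_mul_I])) using 2 with n
  rw [eval_gegenbauer_cos, Finset.sum_mul]
  refine Finset.sum_congr rfl fun p hp => ?_
  rw [← Finset.HasAntidiagonal.mem_antidiagonal.1 hp, mul_pow, mul_pow, pow_add]
  ring

/-- A majorant of the Gegenbauer polynomials on `[-1, 1]`. -/
noncomputable def gegenbauerBound (b : ℝ) (n : ℕ) : ℝ :=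
  ∑ p ∈ Finset.HasAntidiagonal.antidiagonal n, binomCoeff b p.1 * binomCoeff b p.2

lemma gegenbauerBound_nonneg {b : ℝ} (hb : 0 ≤ b) (n : ℕ) : 0 ≤ gegenbauerBound b n :=
  Finset.sum_nonneg fun _ _ => mul_nonneg (binomCoeff_nonneg hb _) (binomCoeff_nonneg hb _)

lemma norm_eval_gegenbauer_le {β : ℂ} {b : ℝ} (hb : ‖β‖ ≤ b) (ψ : ℝ) (n : ℕ) :
    ‖(gegenbauer β n).eval (Real.cos ψ : ℂ)‖ ≤ gegenbauerBound b n := by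
  rw [eval_gegenbauer_cos]
  refine norm_sum_le_of_le _ fun p _ => ?_
  have h1 : ‖exp (ψ * I)‖ = 1 := norm_exp_ofReal_mul_I ψ
  have h2 : ‖exp (-(ψ * I))‖ = 1 := by simpa using norm_mul_exp_neg_mul_I ψ 1
  rw [norm_mul, norm_mul, norm_mul, norm_pow, norm_pow, h1, h2, one_pow, one_pow, mul_one, mul_one]
  exact mul_le_mul (norm_binomCoeff_le hb _) (norm_binomCoeff_le hb _) (norm_nonneg _)
    (binomCoeff_nonneg ((norm_nonneg _).trans hb) _)

/-- The exponent is linear in b, so raising b by 2k costs only the geometric factor (1 - r)^{-4k},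
which the double series can absorb. -/
lemma hasSum_gegenbauerBound (b : ℝ) {r : ℝ} (hr0 : 0 ≤ r) (hr : r < 1) :
    HasSum (fun n => gegenbauerBound b n * r ^ n) ((1 - r) ^ (-(2 * b))) := by
  have h1 := hasSum_binomCoeff_real b (z := r) (by rwa [abs_of_nonneg hr0])
  have hn := h1.summable.norm
  have h2 : HasSum (fun n => ∑ p ∈ Finset.HasAntidiagonal.antidiagonal n,
      (binomCoeff b p.1 * r ^ p.1) * (binomCoeff b p.2 * r ^ p.2))
      ((1 - r) ^ (-b) * (1 - r) ^ (-b)) := by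
    rw [← h1.tsum_eq, tsum_mul_tsum_eq_tsum_sum_antidiagonal_of_summable_norm hn hn]
    exact (summable_norm_sum_mul_antidiagonal_of_summable_norm hn hn).of_norm.hasSum
  rw [← Real.rpow_add (by linarith), show -b + -b = -(2 * b) by ring] at h2
  convert h2 using 2 with n
  rw [gegenbauerBound, Finset.sum_mul]
  refine Finset.sum_congr rfl fun p hp => ?_
  rw [← Finset.HasAntidiagonal.mem_antidiagonal.1 hp, pow_add]
  ring

/-! ### The Poisson kernel near the origin -/

lemma ascPochhammer_eval_two_mul (β : ℂ) (k : ℕ) :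
    (ascPochhammer ℂ (2 * k)).eval β =
      4 ^ k * ((ascPochhammer ℂ k).eval (β / 2) * (ascPochhammer ℂ k).eval ((β + 1) / 2)) := by
  induction k with
  | zero => simp
  | succ k ih =>
    rw [show 2 * (k + 1) = 2 * k + 1 + 1 by ring, ascPochhammer_succ_eval, ascPochhammer_succ_eval,
      ih, ascPochhammer_succ_eval, ascPochhammer_succ_eval]
    push_cast
    ring

/-- The coefficients `(β)_{2k} / ((β + 1/2)_k k!)`. -/
noncomputable def poissonWeight (β : ℂ) (k : ℕ) : ℂ :=
  (ascPochhammer ℂ (2 * k)).eval β / ((ascPochhammer ℂ k).eval (β + 1 / 2) * k.factorial)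

/-- The coefficients of the Poisson kernel, as a polynomial in `v` and `u`. -/
noncomputable def poissonCoeff (β v u : ℂ) (n : ℕ) : ℂ :=
  ∑ k ∈ Finset.range (n / 2 + 1),
    poissonWeight β k * v ^ k * (gegenbauer (β + (2 * k : ℕ)) (n - 2 * k)).eval u

lemma hasSum_poissonWeight {β : ℂ} (hc : ∀ k : ℕ, β + 1 / 2 + k ≠ 0) {z : ℂ} (hz : ‖4 * z‖ < 1) :
    HasSum (fun k => poissonWeight β k * z ^ k)
      (Gamma (β + 1 / 2) * regHypSeries (β / 2) ((β + 1) / 2) (β + 1 / 2) (4 * z)) := by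
  have h := (hasSum_regHypSeries (β / 2) ((β + 1) / 2) (β + 1 / 2) hz).mul_left (Gamma (β + 1 / 2))
  convert! h using 2 with k
  have hg : Gamma (β + 1 / 2) ≠ 0 := Gamma_ne_zero fun m hm => hc m (by rw [hm]; ring)
  have hp := ascPochhammer_eval_ne_zero hc k
  have hkf : (k.factorial : ℂ) ≠ 0 := by exact_mod_cast k.factorial_ne_zero
  rw [Gamma_add_natCast_eq hc, poissonWeight, ascPochhammer_eval_two_mul, mul_pow, mul_inv]
  rw [show ∀ P Q R G G' W F : ℂ, G * (P * Q * (R * G') * (W / F)) = (G * G') * (P * Q * R * (W / F))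
    from fun P Q R G G' W F => by ring, mul_inv_cancel₀ hg, one_mul, ← one_div]
  field_simp

lemma summable_poissonFamily {β : ℂ} (hc : ∀ k : ℕ, β + 1 / 2 + k ≠ 0) {v : ℂ} (hv : ‖v‖ ≤ 1)
    (ψ : ℝ) {t : ℂ} (ht : ‖t‖ ≤ 1 / 4) :
    Summable fun p : ℕ × ℕ => poissonWeight β p.1 * (v * t ^ 2) ^ p.1 *
      ((gegenbauer (β + (2 * p.1 : ℕ)) p.2).eval (Real.cos ψ : ℂ) * t ^ p.2) := by
  set r : ℝ := 1 / 4 with hr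
  have hbound : Summable fun p : ℕ × ℕ => ‖poissonWeight β p.1‖ * (r ^ 2) ^ p.1 *
      (gegenbauerBound (‖β‖ + 2 * p.1) p.2 * r ^ p.2) := by
    have hs : ∀ k : ℕ, HasSum (fun m => ‖poissonWeight β k‖ * (r ^ 2) ^ k *
        (gegenbauerBound (‖β‖ + 2 * k) m * r ^ m))
        (‖poissonWeight β k‖ * (r ^ 2) ^ k * (1 - r) ^ (-(2 * (‖β‖ + 2 * k)))) := fun k =>
      (hasSum_gegenbauerBound _ (by norm_num) (by norm_num)).mul_left _
    refine (summable_prod_of_nonneg ?_).2 ⟨fun k => (hs k).summable, ?_⟩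
    · intro p
      have : 0 ≤ gegenbauerBound (‖β‖ + 2 * p.1) p.2 := gegenbauerBound_nonneg (by positivity) _
      positivity
    -- Here 16/81 = r² (1 - r)^{-4} for r = 1/4 is the ratio produced by the row sums; four times it
    -- is 64/81 < 1.
    · have h := (hasSum_poissonWeight hc (z := ((16 / 81 : ℝ) : ℂ)) (by
        rw [norm_mul, norm_real]; norm_num)).summable.norm
      refine (h.mul_left ((1 - r) ^ (-(2 * ‖β‖)))).congr fun k => ?_
      rw [(hs k).tsum_eq, norm_mul, norm_pow, norm_real,
        show -(2 * (‖β‖ + 2 * k)) = -(2 * ‖β‖) + (-4) * (k : ℝ) by ring,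
        Real.rpow_add (by norm_num), Real.rpow_mul (by norm_num), Real.rpow_natCast,
        show ((1 : ℝ) - r) ^ (-4 : ℝ) = 256 / 81 by
          rw [show (-4 : ℝ) = -((4 : ℕ) : ℝ) by norm_num, Real.rpow_neg (by norm_num),
            Real.rpow_natCast]
          norm_num,
        show ‖(16 / 81 : ℝ)‖ = r ^ 2 * (256 / 81) by norm_num, mul_pow]
      ring
  refine hbound.of_norm_bounded fun p => ?_
  rw [norm_mul, norm_mul, norm_mul, norm_pow, norm_pow, norm_mul, norm_pow]
  have h1 : ‖v‖ * ‖t‖ ^ 2 ≤ r ^ 2 := by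
    calc ‖v‖ * ‖t‖ ^ 2 ≤ 1 * r ^ 2 := by gcongr
      _ = r ^ 2 := one_mul _
  have h2 : ‖β + (2 * p.1 : ℕ)‖ ≤ ‖β‖ + 2 * p.1 := by
    refine (norm_add_le _ _).trans ?_
    rw [Complex.norm_natCast]; push_cast; exact le_rfl
  have h3 := norm_eval_gegenbauer_le h2 ψ p.2
  have h4 : 0 ≤ gegenbauerBound (‖β‖ + 2 * p.1) p.2 := gegenbauerBound_nonneg (by positivity) _
  gcongr

/-- The Poisson kernel near the origin. -/
lemma hasSum_poissonCoeff_of_norm_le {β : ℂ} (hc : ∀ k : ℕ, β + 1 / 2 + k ≠ 0) {v : ℂ}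
    (hv : ‖v‖ ≤ 1) (ψ : ℝ) {t : ℂ} (ht : ‖t‖ ≤ 1 / 4) :
    ‖4 * (v * t ^ 2 / poissonQuad ψ t ^ 2)‖ < 1 ∧
    HasSum (fun n => poissonCoeff β v (Real.cos ψ : ℂ) n * t ^ n)
      (poissonQuad ψ t ^ (-β) * (Gamma (β + 1 / 2) * regHypSeries (β / 2) ((β + 1) / 2) (β + 1 / 2)
        (4 * (v * t ^ 2 / poissonQuad ψ t ^ 2)))) := by
  have ht1 : ‖t‖ < 1 := by linarith
  have hD0 : poissonQuad ψ t ≠ 0 := slitPlane_ne_zero (poissonQuad_mem_slitPlane ht1 ψ)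
  have hz : ‖4 * (v * t ^ 2 / poissonQuad ψ t ^ 2)‖ < 1 := by
    have h := norm_poissonQuad_ge ht1 ψ
    have h' : (9 / 16 : ℝ) ≤ ‖poissonQuad ψ t‖ := by
      refine le_trans ?_ h
      nlinarith
    have h1 : ‖v‖ * ‖t‖ ^ 2 ≤ 1 / 16 := by
      calc ‖v‖ * ‖t‖ ^ 2 ≤ 1 * (1 / 4) ^ 2 := by gcongr
        _ = 1 / 16 := by norm_num
    rw [norm_mul, norm_div, norm_mul, norm_pow, norm_pow, ← mul_div_assoc, div_lt_one (by positivity)]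
    norm_num
    nlinarith
  refine ⟨hz, ?_⟩
  set a : ℕ × ℕ → ℂ := fun p => poissonWeight β p.1 * (v * t ^ 2) ^ p.1 *
      ((gegenbauer (β + (2 * p.1 : ℕ)) p.2).eval (Real.cos ψ : ℂ) * t ^ p.2) with ha
  have hs : Summable a := summable_poissonFamily hc hv ψ ht
  -- The generating function with parameter β + 2k contributes D^{-β} D^{-2k}.
  have hrow : ∀ k, HasSum (fun m => a (k, m)) (poissonQuad ψ t ^ (-β) *
      (poissonWeight β k * (v * t ^ 2 / poissonQuad ψ t ^ 2) ^ k)) := by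
    intro k
    have h := (hasSum_gegenbauer (β + (2 * k : ℕ)) ψ ht1).mul_left
      (poissonWeight β k * (v * t ^ 2) ^ k)
    rw [neg_add, cpow_add _ _ hD0, cpow_neg _ ((2 * k : ℕ) : ℂ), cpow_natCast, pow_mul] at h
    convert! h using 1
    rw [div_pow, div_eq_mul_inv]
    ring
  have htot : HasSum a (poissonQuad ψ t ^ (-β) * (Gamma (β + 1 / 2) *
      regHypSeries (β / 2) ((β + 1) / 2) (β + 1 / 2)
        (4 * (v * t ^ 2 / poissonQuad ψ t ^ 2)))) := by
    have h1 := hs.hasSum.prod_fiberwise hrow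
    have h2 := (hasSum_poissonWeight hc hz).mul_left (poissonQuad ψ t ^ (-β))
    rw [← h1.unique h2]
    exact hs.hasSum
  -- Regroup by total degree n = m + 2k, extending by zero off the image of (k, m) ↦ (m + 2k, k).
  set b : ℕ × ℕ → ℂ := fun p => if 2 * p.2 ≤ p.1 then a (p.2, p.1 - 2 * p.2) else 0 with hb
  have hinj : Function.Injective fun p : ℕ × ℕ => (p.2 + 2 * p.1, p.1) := by
    rintro ⟨k, m⟩ ⟨k', m'⟩ h
    simp only [Prod.mk.injEq] at h ⊢
    omega
  have hbsum : HasSum b (poissonQuad ψ t ^ (-β) * (Gamma (β + 1 / 2) *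
      regHypSeries (β / 2) ((β + 1) / 2) (β + 1 / 2)
        (4 * (v * t ^ 2 / poissonQuad ψ t ^ 2)))) := by
    refine (hinj.hasSum_iff ?_).1 (?_ : HasSum (b ∘ _) _)
    · rintro ⟨n, k⟩ hnk
      refine if_neg fun hle => hnk ⟨(k, n - 2 * k), ?_⟩
      simp only [Prod.mk.injEq, and_true]
      omega
    · convert htot using 1
      funext p
      simp [hb]
  refine hbsum.prod_fiberwise fun n => ?_
  rw [poissonCoeff, Finset.sum_mul]
  convert! hasSum_sum_of_ne_finset_zero (s := Finset.range (n / 2 + 1)) (f := fun k => b (n, k)) ?_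
    using 1
  · refine Finset.sum_congr rfl fun k hk => ?_
    have hk' : 2 * k ≤ n := by have := Finset.mem_range.1 hk; omega
    simp only [hb, ha, if_pos hk']
    have : t ^ n = t ^ (2 * k) * t ^ (n - 2 * k) := by rw [← pow_add]; congr 1; omega
    rw [this, mul_pow, ← pow_mul]
    ring
  · intro k hk
    refine if_neg fun hle => hk (Finset.mem_range.2 ?_)
    simp only at hle
    omega
  · infer_instance

/-! ### Quadratic transformation from the kernel at θ = θ' = π/2 -/

lemma add_half_add_natCast_ne_zero {β : ℂ} (h2 : ∀ k : ℕ, 2 * β + k ≠ 0) (k : ℕ) :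
    β + 1 / 2 + k ≠ 0 := by
  intro h
  refine h2 (2 * k + 1) ?_
  push_cast
  linear_combination 2 * h

lemma binomCoeff_ne_zero {a : ℂ} (h : ∀ k : ℕ, a + k ≠ 0) (n : ℕ) : binomCoeff a n ≠ 0 :=
  div_ne_zero (ascPochhammer_eval_ne_zero h n) (by exact_mod_cast n.factorial_ne_zero)

lemma gegenbauer_eval_mul_eval_eq_poissonCoeff {β : ℂ} (h2 : ∀ k : ℕ, 2 * β + k ≠ 0) (n : ℕ)
    (x y : ℂ) :
    (gegenbauer β n).eval x * (gegenbauer β n).eval y =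
      binomCoeff (2 * β) n * poissonCoeff β ((1 - x ^ 2) * (1 - y ^ 2)) (x * y) n :=
  gegenbauer_eval_mul_eval (add_half_add_natCast_ne_zero h2) n x y

lemma gegenbauer_eval_zero_odd (β : ℂ) (m : ℕ) : (gegenbauer β (2 * m + 1)).eval 0 = 0 := by
  induction m with
  | zero => simp [gegenbauer]
  | succ m ih =>
    rw [show 2 * (m + 1) + 1 = 2 * m + 1 + 2 by ring, gegenbauer]
    simp [ih]

lemma gegenbauer_eval_zero_even (β : ℂ) (m : ℕ) :
    (gegenbauer β (2 * m)).eval 0 = (-1) ^ m * binomCoeff β m := by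
  induction m with
  | zero => simp [gegenbauer]
  | succ m ih =>
    have hr := congrArg (Polynomial.eval 0) (gegenbauer_rec β (2 * m))
    simp [ih] at hr
    have hb := binomCoeff_succ β m
    have hn : (2 * (m : ℂ) + 2) ≠ 0 := by exact_mod_cast (by omega : 2 * m + 2 ≠ 0)
    apply mul_left_cancel₀ hn
    rw [show 2 * (m + 1) = 2 * m + 2 by ring, hr]
    linear_combination (2 * (-1) ^ m) * hb

lemma poissonCoeff_one_zero_odd {β : ℂ} (h2 : ∀ k : ℕ, 2 * β + k ≠ 0) (m : ℕ) :
    poissonCoeff β 1 0 (2 * m + 1) = 0 := by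
  have h := gegenbauer_eval_mul_eval_eq_poissonCoeff h2 (2 * m + 1) 0 0
  rw [gegenbauer_eval_zero_odd, zero_mul, zero_pow two_ne_zero, sub_zero, mul_one] at h
  exact (mul_eq_zero.1 h.symm).resolve_left (binomCoeff_ne_zero h2 _)

/-- For x = y = 0 the product formula makes this coefficient C_{2m}^β(0)² / C_{2m}^β(1). The values
(β)_m / m! up to sign and (2β)_{2m} / (2m)!, with both Pochhammer symbols of length 2m duplicated,
leave a ₂F₁ coefficient. -/
lemma poissonCoeff_one_zero_even {β : ℂ} (h2 : ∀ k : ℕ, 2 * β + k ≠ 0) (m : ℕ) :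
    poissonCoeff β 1 0 (2 * m) = Gamma (β + 1 / 2) * ((ascPochhammer ℂ m).eval β *
      (ascPochhammer ℂ m).eval (1 / 2) * (Gamma (β + 1 / 2 + m))⁻¹ / m.factorial) := by
  have hc := add_half_add_natCast_ne_zero h2
  have h := gegenbauer_eval_mul_eval_eq_poissonCoeff h2 (2 * m) 0 0
  rw [gegenbauer_eval_zero_even, zero_pow two_ne_zero, sub_zero, mul_one, mul_zero] at h
  have hg : Gamma (β + 1 / 2) ≠ 0 := Gamma_ne_zero fun j hj => hc j (by rw [hj]; ring)
  have hp := ascPochhammer_eval_ne_zero hc m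
  have hmf : (m.factorial : ℂ) ≠ 0 := by exact_mod_cast m.factorial_ne_zero
  have hb := binomCoeff_ne_zero h2 (2 * m)
  have hf := Nat.cast_factorial ℂ (2 * m)
  have hf' := Nat.cast_factorial ℂ m
  have e1 := ascPochhammer_eval_two_mul (2 * β) m
  have e2 := ascPochhammer_eval_two_mul 1 m
  rw [← hf, show ((1 : ℂ) + 1) / 2 = 1 by norm_num, ← hf'] at e2
  rw [show 2 * β / 2 = β by ring, show (2 * β + 1) / 2 = β + 1 / 2 by ring] at e1
  have hβ : (ascPochhammer ℂ m).eval β ≠ 0 := by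
    intro h0
    refine ascPochhammer_eval_ne_zero h2 (2 * m) ?_
    rw [e1, h0]; ring
  have h12 : (ascPochhammer ℂ m).eval (1 / 2 : ℂ) ≠ 0 := by
    intro h0
    rw [h0] at e2
    exact (Nat.cast_ne_zero (R := ℂ)).2 (2 * m).factorial_ne_zero (by rw [e2]; ring)
  have h4 : (4 : ℂ) ^ m ≠ 0 := pow_ne_zero _ (by norm_num)
  have hs : ((-1 : ℂ) ^ m) * (-1) ^ m = 1 := by rw [← mul_pow]; norm_num
  rw [Gamma_add_natCast_eq hc]
  apply mul_left_cancel₀ hb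
  rw [← h, binomCoeff, binomCoeff, e1, e2, mul_mul_mul_comm, hs, one_mul]
  generalize (ascPochhammer ℂ m).eval (1 / 2 : ℂ) = P at *
  generalize β + 1 / 2 = c at *
  field_simp

lemma poissonQuad_pi_div_two (t : ℂ) : poissonQuad (Real.pi / 2) t = 1 + t ^ 2 := by
  rw [poissonQuad, Real.cos_pi_div_two]
  simp

/-- A quadratic transformation of the hypergeometric function, near the origin. -/
lemma regHypSeries_quadratic_of_norm_le {β : ℂ} (h2 : ∀ k : ℕ, 2 * β + k ≠ 0) {u : ℂ}
    (hu : ‖u‖ ≤ 1 / 16) :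
    ‖4 * (u / (1 + u) ^ 2)‖ < 1 ∧ regHypSeries β (1 / 2) (β + 1 / 2) u = (1 + u) ^ (-β) *
      regHypSeries (β / 2) ((β + 1) / 2) (β + 1 / 2) (4 * (u / (1 + u) ^ 2)) := by
  have hc := add_half_add_natCast_ne_zero h2
  have hg : Gamma (β + 1 / 2) ≠ 0 := Gamma_ne_zero fun j hj => hc j (by rw [hj]; ring)
  obtain ⟨t, rfl⟩ := IsAlgClosed.exists_pow_nat_eq u two_pos
  have ht : ‖t‖ ≤ 1 / 4 := by
    rw [norm_pow] at hu
    nlinarith [norm_nonneg t]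
  obtain ⟨hz, hs⟩ := hasSum_poissonCoeff_of_norm_le hc (v := 1) (by simp) (Real.pi / 2) ht
  rw [poissonQuad_pi_div_two, one_mul] at hz hs
  rw [Real.cos_pi_div_two, ofReal_zero] at hs
  refine ⟨hz, ?_⟩
  have h3 := (hasSum_regHypSeries β (1 / 2) (β + 1 / 2) (z := t ^ 2)
    (by linarith)).mul_left (Gamma (β + 1 / 2))
  have hinj : Function.Injective fun m : ℕ => 2 * m := fun a b h => by simpa using h
  have h4 : HasSum ((fun n => poissonCoeff β 1 0 n * t ^ n) ∘ fun m : ℕ => 2 * m)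
      (Gamma (β + 1 / 2) * regHypSeries β (1 / 2) (β + 1 / 2) (t ^ 2)) := by
    convert! h3 using 2 with m
    simp only [Function.comp_apply]
    rw [poissonCoeff_one_zero_even h2, pow_mul]
    ring
  rw [hinj.hasSum_iff] at h4
  · apply mul_left_cancel₀ hg
    rw [h4.unique hs]
    ring
  · intro n hn
    obtain ⟨m, rfl | rfl⟩ := n.even_or_odd'
    · exact absurd ⟨m, rfl⟩ hn
    · rw [poissonCoeff_one_zero_odd h2, zero_mul]

/-! ### Analytic continuation of the hypergeometric function -/

lemma isOpen_one_sub_mem_slitPlane : IsOpen {z : ℂ | 1 - z ∈ slitPlane} :=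
  isOpen_slitPlane.preimage (by fun_prop : Continuous fun z : ℂ => 1 - z)

lemma isPreconnected_one_sub_mem_slitPlane : IsPreconnected {z : ℂ | 1 - z ∈ slitPlane} := by
  have h : {z : ℂ | 1 - z ∈ slitPlane} = (fun z => 1 - z) '' slitPlane := by
    ext z
    constructor
    · intro hz
      exact ⟨1 - z, hz, by simp⟩
    · rintro ⟨w, hw, rfl⟩
      simpa using hw
  rw [h]
  exact (starConvex_one_slitPlane.isPathConnected one_mem_slitPlane).isConnected.isPreconnected.image _
    (by fun_prop : Continuous fun z : ℂ => 1 - z).continuousOn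

lemma IsRegHypBranch.eqOn {a b c : ℂ} {f g : ℂ → ℂ} (hf : IsRegHypBranch a b c f)
    (hg : IsRegHypBranch a b c g) : Set.EqOn f g {z : ℂ | 1 - z ∈ slitPlane} := by
  refine (hf.1.analyticOnNhd isOpen_one_sub_mem_slitPlane).eqOn_of_preconnected_of_eventuallyEq
    (hg.1.analyticOnNhd isOpen_one_sub_mem_slitPlane) isPreconnected_one_sub_mem_slitPlane
    (z₀ := 0) (by simp) ?_
  filter_upwards [Metric.ball_mem_nhds (0 : ℂ) one_pos] with z hz
  rw [mem_ball_zero_iff] at hz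
  rw [hf.2 z hz, hg.2 z hz]

/-- Branches are unique, so the arbitrary choice in `regHyp` may be computed with any explicit
branch. -/
lemma IsRegHypBranch.regHyp_eq {a b c : ℂ} {f : ℂ → ℂ} (hf : IsRegHypBranch a b c f) {z : ℂ}
    (hz : 1 - z ∈ slitPlane) : regHyp a b c z = f z := by
  rw [regHyp]
  split_ifs with h1 h2
  · exact (hf.2 z h1).symm
  · exact h2.choose_spec.eqOn hf hz
  · exact absurd ⟨f, hf⟩ h2

/-- The variable of the quadratic transformation. -/
noncomputable def quadraticVar (w : ℂ) : ℂ :=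
  (1 - (1 - w) ^ (1 / 2 : ℂ)) / (1 + (1 - w) ^ (1 / 2 : ℂ))

lemma sqrt_re_pos {z : ℂ} (hz : z ∈ slitPlane) : 0 < (z ^ (1 / 2 : ℂ)).re := by
  have h0 := slitPlane_ne_zero hz
  rw [cpow_def_of_ne_zero h0, exp_re]
  refine mul_pos (Real.exp_pos _) (Real.cos_pos_of_mem_Ioo ?_)
  have h1 := (mem_slitPlane_iff_arg.1 hz).1
  have h2 := arg_le_pi z
  have h3 := neg_pi_lt_arg z
  have h4 : arg z < Real.pi := lt_of_le_of_ne h2 h1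
  have h5 : (log z * (1 / 2)).im = arg z / 2 := by
    rw [show log z * (1 / 2) = ((1 / 2 : ℝ) : ℂ) * log z by push_cast; ring, im_ofReal_mul, log_im]
    ring
  rw [h5]
  constructor <;> linarith

lemma sqrt_sq (z : ℂ) : (z ^ (1 / 2 : ℂ)) ^ 2 = z := by
  rw [← cpow_nat_mul]
  norm_num

lemma one_add_sqrt_ne_zero {z : ℂ} (hz : z ∈ slitPlane) : 1 + z ^ (1 / 2 : ℂ) ≠ 0 := by
  intro h
  have := congrArg re h
  have h' := sqrt_re_pos hz
  rw [add_re, one_re, zero_re] at this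
  linarith

/-- The principal root s of 1 - w has positive real part, and s ↦ (1 - s)/(1 + s) maps the right
half-plane into the unit disc. -/
lemma norm_quadraticVar_lt_one {w : ℂ} (hw : 1 - w ∈ slitPlane) : ‖quadraticVar w‖ < 1 := by
  have hs := sqrt_re_pos hw
  have h0 := one_add_sqrt_ne_zero hw
  rw [quadraticVar, norm_div, div_lt_one (norm_pos_iff.2 h0)]
  generalize (1 - w) ^ (1 / 2 : ℂ) = s at *
  rw [← sq_lt_sq₀ (norm_nonneg _) (norm_nonneg _), ← normSq_eq_norm_sq, ← normSq_eq_norm_sq,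
    normSq_apply, normSq_apply]
  simp
  nlinarith

lemma quadraticVar_div_sq {w : ℂ} (hw : 1 - w ∈ slitPlane) :
    4 * (quadraticVar w / (1 + quadraticVar w) ^ 2) = w := by
  have h0 := one_add_sqrt_ne_zero hw
  have hs := sqrt_sq (1 - w)
  rw [quadraticVar]
  generalize (1 - w) ^ (1 / 2 : ℂ) = s at *
  have h1 : 1 + (1 - s) / (1 + s) = 2 / (1 + s) := by field_simp; ring
  rw [h1]
  field_simp
  linear_combination -4 * hs

lemma differentiableOn_quadraticVar :
    DifferentiableOn ℂ quadraticVar {z : ℂ | 1 - z ∈ slitPlane} := by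
  have h : DifferentiableOn ℂ (fun w : ℂ => (1 - w) ^ (1 / 2 : ℂ)) {z : ℂ | 1 - z ∈ slitPlane} :=
    DifferentiableOn.cpow (by fun_prop) (by fun_prop) fun z hz => hz
  exact (h.const_sub 1).div (h.const_add 1) fun z hz => one_add_sqrt_ne_zero hz

lemma quadraticVar_zero : quadraticVar 0 = 0 := by simp [quadraticVar]

/-- The analytic continuation of the hypergeometric function defining the Legendre function of the
second kind. -/
noncomputable def quadraticBranch (β w : ℂ) : ℂ :=
  (1 + quadraticVar w) ^ β * regHypSeries β (1 / 2) (β + 1 / 2) (quadraticVar w)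

/-- `quadraticVar` sends the whole cut plane into the unit disc, where the transformed series
converges. Near 0 the quadratic transformation identifies the two functions, and the identity
theorem carries this to the disc. -/
lemma isRegHypBranch_quadraticBranch {β : ℂ} (h2 : ∀ k : ℕ, 2 * β + k ≠ 0) :
    IsRegHypBranch (β / 2) ((β + 1) / 2) (β + 1 / 2) (quadraticBranch β) := by
  have hd : DifferentiableOn ℂ (quadraticBranch β) {z : ℂ | 1 - z ∈ slitPlane} := by
    refine DifferentiableOn.mul (DifferentiableOn.cpow (differentiableOn_quadraticVar.const_add 1)
      (by fun_prop) fun z hz => mem_slitPlane_of_norm_lt_one (norm_quadraticVar_lt_one hz)) ?_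
    exact (differentiableOn_regHypSeries β (1 / 2) (β + 1 / 2)).comp differentiableOn_quadraticVar
      fun z hz => mem_ball_zero_iff.2 (norm_quadraticVar_lt_one hz)
  have hsub : Metric.ball (0 : ℂ) 1 ⊆ {z : ℂ | 1 - z ∈ slitPlane} := by
    intro z hz
    have := mem_slitPlane_of_norm_lt_one (z := -z) (by simpa using hz)
    simpa [sub_eq_add_neg] using this
  refine ⟨hd, ?_⟩
  have heq : Set.EqOn (quadraticBranch β) (regHypSeries (β / 2) ((β + 1) / 2) (β + 1 / 2))
      (Metric.ball 0 1) := by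
    refine ((hd.mono hsub).analyticOnNhd Metric.isOpen_ball).eqOn_of_preconnected_of_eventuallyEq
      ((differentiableOn_regHypSeries _ _ _).analyticOnNhd Metric.isOpen_ball)
      (convex_ball (0 : ℂ) 1).isPreconnected (z₀ := 0) (by simp) ?_
    have hcont : ContinuousAt quadraticVar 0 :=
      (differentiableOn_quadraticVar.differentiableAt
        (isOpen_one_sub_mem_slitPlane.mem_nhds (by simp))).continuousAt
    have hev := hcont.eventually (Metric.closedBall_mem_nhds _ (by norm_num : (0 : ℝ) < 1 / 16))
    filter_upwards [hev, Metric.ball_mem_nhds (0 : ℂ) one_pos] with w hw hw1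
    rw [quadraticVar_zero] at hw
    have hw' : ‖quadraticVar w‖ ≤ 1 / 16 := by simpa using hw
    have hq := (regHypSeries_quadratic_of_norm_le h2 hw').2
    rw [quadraticVar_div_sq (hsub hw1)] at hq
    have h1 : 1 + quadraticVar w ≠ 0 :=
      slitPlane_ne_zero (mem_slitPlane_of_norm_lt_one (norm_quadraticVar_lt_one (hsub hw1)))
    rw [quadraticBranch, hq, ← mul_assoc, ← cpow_add _ _ h1, add_neg_cancel, cpow_zero, one_mul]
  exact fun z hz => heq (mem_ball_zero_iff.2 hz)

/-! ### Continuation of the kernel to the unit disc -/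

/-- A power series identity near the origin extends to the disc of holomorphy. -/
lemma hasSum_of_eventually_hasSum {G : ℂ → ℂ} (hG : DifferentiableOn ℂ G (Metric.ball 0 1))
    {s : ℕ → ℂ} (hs : ∀ᶠ t in 𝓝 (0 : ℂ), HasSum (fun n => s n * t ^ n) (G t)) {t : ℂ}
    (ht : ‖t‖ < 1) : HasSum (fun n => s n * t ^ n) (G t) := by
  have h1 : HasFPowerSeriesAt G (FormalMultilinearSeries.ofScalars ℂ s) 0 := by
    rw [hasFPowerSeriesAt_iff]
    filter_upwards [hs] with z hz
    simpa [FormalMultilinearSeries.coeff_ofScalars, mul_comm] using hz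
  obtain ⟨r, hr1, hr2⟩ := exists_between ht
  have hr0 : 0 < r := (norm_nonneg t).trans_lt hr1
  lift r to NNReal using hr0.le
  have h2 := (hG.mono (Metric.closedBall_subset_ball hr2)).hasFPowerSeriesOnBall
    (by exact_mod_cast hr0)
  -- Both series represent G near 0, so they are equal; the Cauchy series converges on the disc of
  -- radius r, which contains t.
  have h3 := h1.eq_formalMultilinearSeries h2.hasFPowerSeriesAt
  have h4 := h2.hasSum (y := t) (by
    simpa [enorm_eq_nnnorm, ← NNReal.coe_lt_coe] using hr1)
  rw [← h3, zero_add] at h4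
  simpa [FormalMultilinearSeries.ofScalars_apply_eq, mul_comm] using h4

lemma poissonQuad_ne_zero {t : ℂ} (ht : ‖t‖ < 1) (ψ : ℝ) : poissonQuad ψ t ≠ 0 :=
  slitPlane_ne_zero (poissonQuad_mem_slitPlane ht ψ)

lemma one_sub_sq_mem_slitPlane {ζ : ℂ} (h : ∀ ρ : ℝ, 1 ≤ |ρ| → ζ ≠ ρ) :
    1 - ζ ^ 2 ∈ slitPlane := by
  by_contra hn
  rw [mem_slitPlane_iff, not_or, not_lt, not_not] at hn
  obtain ⟨hre, him⟩ := hn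
  set p : ℝ := (ζ ^ 2).re with hp
  have hp1 : 1 ≤ p := by rw [sub_re, one_re] at hre; linarith
  have hpi : (ζ ^ 2).im = 0 := by rw [sub_im, one_im] at him; linarith
  have hz : ζ ^ 2 = ((Real.sqrt p : ℝ) : ℂ) ^ 2 := by
    rw [← ofReal_pow, Real.sq_sqrt (by linarith)]
    exact Complex.ext (by simp [hp]) (by simp [hpi])
  have hsq : 1 ≤ Real.sqrt p := Real.one_le_sqrt.2 hp1
  rcases sq_eq_sq_iff_eq_or_eq_neg.1 hz with h1 | h1
  · exact h _ (by rwa [abs_of_nonneg (by linarith)]) h1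
  · exact h (-Real.sqrt p) (by rwa [abs_neg, abs_of_nonneg (by linarith)]) (by rw [h1]; simp)

/-- The angle with cosine `cos θ cos θ'`. -/
noncomputable def poissonAngle (θ θ' : ℝ) : ℝ := Real.arccos (Real.cos θ * Real.cos θ')

lemma cos_poissonAngle (θ θ' : ℝ) : Real.cos (poissonAngle θ θ') = Real.cos θ * Real.cos θ' := by
  have h : |Real.cos θ * Real.cos θ'| ≤ 1 := by
    rw [abs_mul]
    exact mul_le_one₀ (Real.abs_cos_le_one θ) (abs_nonneg _) (Real.abs_cos_le_one θ')
  exact Real.cos_arccos (abs_le.1 h).1 (abs_le.1 h).2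

/-- Otherwise 1/χ = ρ is real with |ρ| ≥ 1, and 1 + t² - 2tκ = 0 with κ = cos θ cos θ' + sin θ sin
θ' / ρ. This κ lies between cos(θ + θ') and cos(θ - θ'), so it is a cosine and both roots of the
quadratic have modulus 1, contradicting |t| < 1. -/
lemma one_sub_poisson_mem_slitPlane {θ θ' : ℝ} (hθ : 0 < Real.sin θ) (hθ' : 0 < Real.sin θ')
    {t : ℂ} (ht : ‖t‖ < 1) :
    1 - (2 * t * Real.sin θ * Real.sin θ' / poissonQuad (poissonAngle θ θ') t) ^ 2 ∈ slitPlane := by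
  have hD := poissonQuad_ne_zero ht (poissonAngle θ θ')
  refine one_sub_sq_mem_slitPlane fun ρ hρ h => ?_
  have hρ0 : ρ ≠ 0 := by rintro rfl; norm_num at hρ
  have hρi : |ρ⁻¹| ≤ 1 := by rw [abs_inv]; exact inv_le_one_of_one_le₀ hρ
  set κ : ℝ := Real.cos θ * Real.cos θ' + Real.sin θ * Real.sin θ' * ρ⁻¹ with hκ
  have h1 := Real.neg_one_le_cos (θ - θ')
  have h2 := Real.cos_le_one (θ - θ')
  have h3 := Real.neg_one_le_cos (θ + θ')
  have h4 := Real.cos_le_one (θ + θ')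
  rw [Real.cos_sub] at h1 h2
  rw [Real.cos_add] at h3 h4
  have hss : 0 < Real.sin θ * Real.sin θ' := mul_pos hθ hθ'
  have hκ1 : -1 ≤ κ := by nlinarith [abs_le.1 hρi]
  have hκ2 : κ ≤ 1 := by nlinarith [abs_le.1 hρi]
  refine poissonQuad_ne_zero ht (Real.arccos κ) ?_
  rw [div_eq_iff hD, poissonQuad, cos_poissonAngle] at h
  have hρc : (ρ : ℂ) ≠ 0 := by exact_mod_cast hρ0
  rw [poissonQuad, Real.cos_arccos hκ1 hκ2, hκ]
  push_cast at h ⊢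
  apply mul_left_cancel₀ hρc
  field_simp
  linear_combination -h

/-- The closed form of the Poisson kernel, continued to the whole unit disc. -/
noncomputable def continuedKernel (β : ℂ) (θ θ' : ℝ) (t : ℂ) : ℂ :=
  poissonQuad (poissonAngle θ θ') t ^ (-β) * (Gamma (β + 1 / 2) * quadraticBranch β
    ((2 * t * Real.sin θ * Real.sin θ' / poissonQuad (poissonAngle θ θ') t) ^ 2))

lemma differentiableOn_continuedKernel {β : ℂ} (h2 : ∀ k : ℕ, 2 * β + k ≠ 0) {θ θ' : ℝ}
    (hθ : 0 < Real.sin θ) (hθ' : 0 < Real.sin θ') :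
    DifferentiableOn ℂ (continuedKernel β θ θ') (Metric.ball 0 1) := by
  have hq : DifferentiableOn ℂ (poissonQuad (poissonAngle θ θ')) (Metric.ball 0 1) := by
    unfold poissonQuad; fun_prop
  have hw : DifferentiableOn ℂ (fun t => (2 * t * Real.sin θ * Real.sin θ' /
      poissonQuad (poissonAngle θ θ') t) ^ 2) (Metric.ball 0 1) :=
    (DifferentiableOn.div (by fun_prop) hq
      fun t ht => poissonQuad_ne_zero (mem_ball_zero_iff.1 ht) _).pow 2
  refine (hq.cpow (by fun_prop) fun t ht =>
    poissonQuad_mem_slitPlane (mem_ball_zero_iff.1 ht) _).mul (DifferentiableOn.const_mul ?_ _)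
  exact (isRegHypBranch_quadraticBranch h2).1.comp hw fun t ht =>
    one_sub_poisson_mem_slitPlane hθ hθ' (mem_ball_zero_iff.1 ht)

lemma hasSum_continuedKernel {β : ℂ} (h2 : ∀ k : ℕ, 2 * β + k ≠ 0) {θ θ' : ℝ}
    (hθ : 0 < Real.sin θ) (hθ' : 0 < Real.sin θ') {t : ℂ} (ht : ‖t‖ < 1) :
    HasSum (fun n => poissonCoeff β ((1 - (Real.cos θ : ℂ) ^ 2) * (1 - (Real.cos θ' : ℂ) ^ 2))
      ((Real.cos θ : ℂ) * Real.cos θ') n * t ^ n) (continuedKernel β θ θ' t) := by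
  refine hasSum_of_eventually_hasSum (differentiableOn_continuedKernel h2 hθ hθ') ?_ ht
  filter_upwards [Metric.closedBall_mem_nhds (0 : ℂ) (by norm_num : (0 : ℝ) < 1 / 4)] with z hz
  rw [mem_closedBall_zero_iff] at hz
  have e : ∀ x : ℝ, 1 - (Real.cos x : ℂ) ^ 2 = ((Real.sin x ^ 2 : ℝ) : ℂ) := fun x => by
    rw [Real.sin_sq]; push_cast; rfl
  have hn : ∀ x : ℝ, ‖((Real.sin x ^ 2 : ℝ) : ℂ)‖ ≤ 1 := fun x => by
    rw [norm_real, Real.norm_of_nonneg (sq_nonneg _)]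
    exact Real.sin_sq_le_one x
  obtain ⟨h3, h4⟩ := hasSum_poissonCoeff_of_norm_le (add_half_add_natCast_ne_zero h2)
    (v := (1 - (Real.cos θ : ℂ) ^ 2) * (1 - (Real.cos θ' : ℂ) ^ 2))
    (by rw [e, e, norm_mul]; exact mul_le_one₀ (hn _) (norm_nonneg _) (hn _))
    (poissonAngle θ θ') hz
  rw [← (isRegHypBranch_quadraticBranch h2).2 _ h3, cos_poissonAngle, ofReal_mul] at h4
  convert! h4 using 1
  rw [continuedKernel]
  congr 3
  rw [e, e]
  push_cast
  ring

/-! ### Principal powers and the closed form -/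

lemma Complex.mul_cpow_of_arg_add_mem {x y : ℂ} (hx : x ≠ 0) (hy : y ≠ 0)
    (h : arg x + arg y ∈ Set.Ioc (-Real.pi) Real.pi) (s : ℂ) : (x * y) ^ s = x ^ s * y ^ s := by
  rw [cpow_def_of_ne_zero (mul_ne_zero hx hy), cpow_def_of_ne_zero hx, cpow_def_of_ne_zero hy,
    (log_mul_eq_add_log_iff hx hy).2 h, add_mul, exp_add]

lemma Complex.ofReal_mul_cpow {r : ℝ} (hr : 0 < r) {z : ℂ} (hz : z ≠ 0) (s : ℂ) :
    ((r : ℂ) * z) ^ s = (r : ℂ) ^ s * z ^ s := by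
  refine mul_cpow_of_arg_add_mem (by exact_mod_cast hr.ne') hz ?_ s
  rw [arg_ofReal_of_nonneg hr.le, zero_add]
  exact arg_mem_Ioc z

lemma poissonChi_eq (θ θ' : ℝ) (t : ℂ) : poissonChi θ θ' t =
    poissonQuad (poissonAngle θ θ') t / (2 * t * Real.sin θ * Real.sin θ') := by
  rw [poissonChi, poissonQuad, cos_poissonAngle]
  push_cast
  ring_nf

lemma poissonChi_im {θ θ' : ℝ} {t : ℂ} (ht0 : t ≠ 0) : (poissonChi θ θ' t).im =
    -(t.im * ((1 - ‖t‖ ^ 2) / (2 * Real.sin θ * Real.sin θ' * ‖t‖ ^ 2))) := by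
  have h : poissonChi θ θ' t = ((1 / (2 * Real.sin θ * Real.sin θ') : ℝ) : ℂ) *
      (t⁻¹ + t - ((2 * Real.cos θ * Real.cos θ' : ℝ) : ℂ)) := by
    rw [poissonChi]
    push_cast
    field_simp
  have hn : ‖t‖ ≠ 0 := norm_ne_zero_iff.2 ht0
  rw [h, im_ofReal_mul, sub_im, add_im, inv_im, ofReal_im, normSq_eq_norm_sq]
  field_simp
  ring

lemma poissonChi_sign {θ θ' : ℝ} (hθ : 0 < Real.sin θ) (hθ' : 0 < Real.sin θ')
    {t : ℂ} (ht : ‖t‖ < 1) (ht0 : t ≠ 0) :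
    ∃ a : ℝ, 0 < a ∧ (poissonChi θ θ' t).im = -(t.im * a) := by
  have hn : 0 < ‖t‖ := norm_pos_iff.2 ht0
  refine ⟨_, ?_, poissonChi_im ht0⟩
  have : 0 < 1 - ‖t‖ ^ 2 := by nlinarith
  positivity

/-- Inside the disc Im χ and Im t have opposite signs, so the arguments add without wrapping and
(χt)^s splits. -/
lemma arg_poissonChi_add_arg {θ θ' : ℝ} (hθ : 0 < Real.sin θ) (hθ' : 0 < Real.sin θ')
    {t : ℂ} (ht : ‖t‖ < 1)
    (hts : t ∈ slitPlane) :
    arg (poissonChi θ θ' t) + arg t ∈ Set.Ioc (-Real.pi) Real.pi := by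
  obtain ⟨a, ha, him⟩ := poissonChi_sign hθ hθ' ht (slitPlane_ne_zero hts)
  have h1 := neg_pi_lt_arg (poissonChi θ θ' t)
  have h2 := arg_le_pi (poissonChi θ θ' t)
  have h3 := neg_pi_lt_arg t
  have h4 := arg_le_pi t
  rcases lt_trichotomy t.im 0 with h | h | h
  · have h5 : arg t < 0 := arg_neg_iff.2 h
    have h6 : 0 ≤ arg (poissonChi θ θ' t) := arg_nonneg_iff.2 (by rw [him]; nlinarith)
    constructor <;> linarith
  · have h5 : arg t = 0 := by
      refine arg_eq_zero_iff.2 ⟨?_, h⟩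
      rcases mem_slitPlane_iff.1 hts with h' | h'
      · exact h'.le
      · exact absurd h h'
    rw [h5, add_zero]
    exact ⟨h1, h2⟩
  · have h5 : 0 ≤ arg t := arg_nonneg_iff.2 h.le
    have h6 : arg (poissonChi θ θ' t) < 0 := arg_neg_iff.2 (by rw [him]; nlinarith)
    constructor <;> linarith

lemma poissonChi_sub_one_mem_slitPlane {θ θ' : ℝ} (hθ : 0 < Real.sin θ) (hθ' : 0 < Real.sin θ')
    {t : ℂ} (ht : ‖t‖ < 1) (hts : t ∈ slitPlane) :
    poissonChi θ θ' t - 1 ∈ slitPlane := by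
  obtain ⟨a, ha, him⟩ := poissonChi_sign hθ hθ' ht (slitPlane_ne_zero hts)
  rw [mem_slitPlane_iff]
  by_cases h : t.im = 0
  · left
    have hre : 0 < t.re := (mem_slitPlane_iff.1 hts).resolve_right (not_not.2 h)
    obtain ⟨r, rfl⟩ : ∃ r : ℝ, t = r := ⟨t.re, Complex.ext (by simp) (by simp [h])⟩
    rw [ofReal_re] at hre
    rw [norm_real, Real.norm_of_nonneg hre.le] at ht
    have hc := Real.cos_le_one (θ - θ')
    rw [Real.cos_sub] at hc
    have hp : 0 < 2 * r * Real.sin θ * Real.sin θ' := by positivity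
    have e : poissonChi θ θ' r - 1 = (((1 + r ^ 2 - 2 * r * Real.cos θ * Real.cos θ') /
        (2 * r * Real.sin θ * Real.sin θ') - 1 : ℝ) : ℂ) := by
      rw [poissonChi]; push_cast; rfl
    rw [e, ofReal_re, sub_pos, lt_div_iff₀ hp]
    -- For t = r > 0 the claim χ > 1 reads 1 + r² - 2r cos(θ - θ') > 0, and the left side is at
    -- least (1 - r)².
    nlinarith [mul_nonneg hre.le (sub_nonneg.2 hc), pow_pos (sub_pos.2 ht) 2]
  · right
    rw [sub_im, one_im, sub_zero, him]
    simp [h, ha.ne']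

/-- Taking powers in D = 2 sin θ sin θ' χ t converts χ^{-β} t^{-β} into D^{-β}; the duplication
formula for Γ(λ + 1/2) Γ(λ + 1) reconciles the constants. -/
lemma poissonClosedForm_eq {lam : ℂ} (h2 : ∀ k : ℕ, 2 * (lam + 1 / 2) + k ≠ 0) {θ θ' : ℝ} (hθ : 0 < Real.sin θ)
    (hθ' : 0 < Real.sin θ') {t : ℂ} (ht : ‖t‖ < 1) (hts : t ∈ slitPlane) :
    poissonClosedForm lam θ θ' t =
      ((Real.sin θ / 2 : ℝ) : ℂ) ^ lam * (Gamma (lam + 1))⁻¹ *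
        (((Real.sin θ' / 2 : ℝ) : ℂ) ^ lam * (Gamma (lam + 1))⁻¹) *
          continuedKernel (lam + 1 / 2) θ θ' t := by
  have ht0 := slitPlane_ne_zero hts
  have hsc : (Real.sin θ : ℂ) ≠ 0 := by exact_mod_cast hθ.ne'
  have hsc' : (Real.sin θ' : ℂ) ≠ 0 := by exact_mod_cast hθ'.ne'
  have hD := poissonQuad_ne_zero ht (poissonAngle θ θ')
  have hss : 0 < Real.sin θ * Real.sin θ' := mul_pos hθ hθ'
  have hχ := poissonChi_eq θ θ' t
  have hχ0 : poissonChi θ θ' t ≠ 0 := by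
    rw [hχ]
    exact div_ne_zero hD (mul_ne_zero (mul_ne_zero (mul_ne_zero two_ne_zero ht0) hsc) hsc')
  have hw : 1 / poissonChi θ θ' t ^ 2 =
      (2 * t * Real.sin θ * Real.sin θ' / poissonQuad (poissonAngle θ θ') t) ^ 2 := by
    rw [hχ, one_div, ← inv_pow, inv_div]
  have hF : regHyp ((lam + 1 / 2) / 2) ((lam + 1 / 2 + 1) / 2) (lam + 1 / 2 + 1 / 2)
      (1 / poissonChi θ θ' t ^ 2) = quadraticBranch (lam + 1 / 2)
      ((2 * t * Real.sin θ * Real.sin θ' / poissonQuad (poissonAngle θ θ') t) ^ 2) := by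
    rw [hw]
    exact (isRegHypBranch_quadraticBranch h2).regHyp_eq
      (one_sub_poisson_mem_slitPlane hθ hθ' ht)
  have hpow : poissonQuad (poissonAngle θ θ') t ^ (lam + 1 / 2) = 2 ^ (lam + 1 / 2) *
      (((Real.sin θ * Real.sin θ' : ℝ) : ℂ) ^ lam * (Real.sqrt (Real.sin θ * Real.sin θ') : ℂ)) *
      (poissonChi θ θ' t ^ (lam + 1 / 2) * t ^ (lam + 1 / 2)) := by
    have e : poissonQuad (poissonAngle θ θ') t = ((2 : ℝ) : ℂ) *
        (((Real.sin θ * Real.sin θ' : ℝ) : ℂ) * (poissonChi θ θ' t * t)) := by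
      rw [hχ, ofReal_mul, ofReal_ofNat]; field_simp
    have hssc : ((Real.sin θ * Real.sin θ' : ℝ) : ℂ) ≠ 0 := by exact_mod_cast hss.ne'
    rw [e, ofReal_mul_cpow two_pos (mul_ne_zero hssc (mul_ne_zero hχ0 ht0)),
      ofReal_mul_cpow hss (mul_ne_zero hχ0 ht0), mul_cpow_of_arg_add_mem hχ0 ht0
      (arg_poissonChi_add_arg hθ hθ' ht hts), cpow_add _ _ hssc, Real.sqrt_eq_rpow,
      ofReal_cpow hss.le]
    push_cast
    ring
  have hdup := Gamma_mul_Gamma_add_half (lam + 1 / 2)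
  have hexp : (2 : ℂ) ^ (1 - 2 * (lam + 1 / 2)) = (2 ^ lam * 2 ^ lam)⁻¹ := by
    rw [← cpow_add _ _ two_ne_zero, ← cpow_neg]
    congr 1; ring
  have hhalf : ∀ s : ℝ, 0 < s → ((s : ℝ) : ℂ) ^ lam = 2 ^ lam * ((s / 2 : ℝ) : ℂ) ^ lam := by
    intro s hs
    have h := mul_cpow_ofReal_nonneg (a := 2) (b := s / 2) (by norm_num) (by linarith) lam
    rwa [← ofReal_mul, mul_div_cancel₀ _ (two_ne_zero' ℝ), ofReal_ofNat] at h
  have hsplit : ((Real.sin θ * Real.sin θ' : ℝ) : ℂ) ^ lam =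
      2 ^ lam * 2 ^ lam * (((Real.sin θ / 2 : ℝ) : ℂ) ^ lam * ((Real.sin θ' / 2 : ℝ) : ℂ) ^ lam) := by
    rw [ofReal_mul, mul_cpow_ofReal_nonneg hθ.le hθ'.le, hhalf _ hθ, hhalf _ hθ']
    ring
  have hpi : (Real.sqrt Real.pi : ℂ) * Real.sqrt Real.pi = Real.pi := by
    rw [← ofReal_mul, Real.mul_self_sqrt Real.pi_pos.le]
  have hc := add_half_add_natCast_ne_zero h2
  have hg1 : Gamma (lam + 1) ≠ 0 := Gamma_ne_zero fun j hj => hc j (by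
    linear_combination hj)
  have hg2 : Gamma (2 * lam + 1) ≠ 0 := Gamma_ne_zero fun j hj => h2 j (by
    linear_combination hj)
  have hpi0 : (Real.sqrt Real.pi : ℂ) ≠ 0 := by
    exact_mod_cast (Real.sqrt_pos.2 Real.pi_pos).ne'
  have h20 : (2 : ℂ) ^ lam ≠ 0 := by rw [cpow_ne_zero_iff]; simp
  have h21 : (2 : ℂ) ^ (lam + 1 / 2) ≠ 0 := by rw [cpow_ne_zero_iff]; simp
  have hχp : poissonChi θ θ' t ^ (lam + 1 / 2) ≠ 0 := by rw [cpow_ne_zero_iff]; simp [hχ0]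
  have htp : t ^ (lam + 1 / 2) ≠ 0 := by rw [cpow_ne_zero_iff]; simp [ht0]
  have hsq : (Real.sqrt (Real.sin θ * Real.sin θ') : ℂ) ≠ 0 := by
    exact_mod_cast (Real.sqrt_pos.2 hss).ne'
  have hs1 : ((Real.sin θ / 2 : ℝ) : ℂ) ^ lam ≠ 0 := by
    rw [cpow_ne_zero_iff]; left; exact_mod_cast (half_pos hθ).ne'
  have hs2 : ((Real.sin θ' / 2 : ℝ) : ℂ) ^ lam ≠ 0 := by
    rw [cpow_ne_zero_iff]; left; exact_mod_cast (half_pos hθ').ne'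
  rw [show lam + 1 / 2 + 1 / 2 = lam + 1 by ring, show 2 * (lam + 1 / 2) = 2 * lam + 1 by ring] at *
  rw [poissonClosedForm, legendreQ, olverQ, continuedKernel,
    show lam - 1 / 2 + 1 = lam + 1 / 2 by ring, show lam - 1 / 2 + 2 = lam + 1 / 2 + 1 by ring,
    show lam - 1 / 2 + 3 / 2 = lam + 1 by ring, hF, cpow_neg, hpow, hsplit,
    show lam + 1 / 2 + 1 / 2 = lam + 1 by ring, ← hpi]
  generalize quadraticBranch (lam + 1 / 2) _ = F
  rw [hexp] at hdup
  generalize Gamma (lam + 1 / 2) = g0 at *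
  generalize lam + 1 / 2 = β at *
  generalize ((Real.sin θ / 2 : ℝ) : ℂ) ^ lam = S1 at *
  generalize ((Real.sin θ' / 2 : ℝ) : ℂ) ^ lam = S2 at *
  generalize (Real.sqrt (Real.sin θ * Real.sin θ') : ℂ) = S3 at *
  generalize (Real.sqrt Real.pi : ℂ) = p at *
  generalize poissonChi θ θ' t ^ β = X at *
  generalize t ^ β = T at *
  generalize (2 : ℂ) ^ β = B at *
  generalize (2 : ℂ) ^ lam = L at *
  generalize Gamma (lam + 1) = g1 at *
  generalize Gamma (2 * lam + 1) = g2 at *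
  field_simp at hdup ⊢
  linear_combination F * hdup

/-! ### Summation, the degenerate case and the theorem -/

lemma hasSum_poissonTerm {lam : ℂ} (h2 : ∀ k : ℕ, 2 * (lam + 1 / 2) + k ≠ 0) {θ θ' : ℝ}
    (hθ : θ ∈ Set.Ioo 0 Real.pi) (hθ' : θ' ∈ Set.Ioo 0 Real.pi) {t : ℂ} (ht : ‖t‖ < 1) :
    HasSum (poissonTerm lam θ θ' t)
      (((Real.sin θ / 2 : ℝ) : ℂ) ^ lam * (Gamma (lam + 1))⁻¹ *
        (((Real.sin θ' / 2 : ℝ) : ℂ) ^ lam * (Gamma (lam + 1))⁻¹) *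
          continuedKernel (lam + 1 / 2) θ θ' t) := by
  have hc : ∀ k : ℕ, lam + 1 + k ≠ 0 := fun k h =>
    add_half_add_natCast_ne_zero h2 k (by linear_combination h)
  convert! (hasSum_continuedKernel h2 (Real.sin_pos_of_mem_Ioo hθ) (Real.sin_pos_of_mem_Ioo hθ')
    ht).mul_left _ using 2 with n
  have hb := binomCoeff_ne_zero h2 n
  have h1 := ferrersP_eq_gegenbauer hc hθ n
  have h1' := ferrersP_eq_gegenbauer hc hθ' n
  have h3 := gegenbauer_eval_mul_eval_eq_poissonCoeff h2 n (Real.cos θ : ℂ) (Real.cos θ' : ℂ)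
  have e : poissonTerm lam θ θ' t n = binomCoeff (2 * lam + 1) n * t ^ n *
      ferrersP (n + lam) (-lam) (Real.cos θ) * ferrersP (n + lam) (-lam) (Real.cos θ') := by
    rw [poissonTerm, binomCoeff]; ring
  -- Each Ferrers function needs its own factor C_n^β(1), and the term carries only one; the product
  -- formula returns the extra one.
  apply mul_left_cancel₀ hb
  rw [e, show 2 * (lam + 1 / 2) = 2 * lam + 1 by ring] at *
  linear_combination t ^ n * binomCoeff (2 * lam + 1) n *
      ferrersP (n + lam) (-lam) (Real.cos θ') * h1 +
    t ^ n * (((Real.sin θ / 2 : ℝ) : ℂ) ^ lam * (Gamma (lam + 1))⁻¹ *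
      (gegenbauer (lam + 1 / 2) n).eval (Real.cos θ : ℂ)) * h1' +
    t ^ n * (((Real.sin θ / 2 : ℝ) : ℂ) ^ lam * (Gamma (lam + 1))⁻¹ *
        (((Real.sin θ' / 2 : ℝ) : ℂ) ^ lam * (Gamma (lam + 1))⁻¹)) * h3

/-- Here λ = -(m + 1). For n > 2m + 1 the factor (2λ + 1)_n vanishes. Otherwise the Ferrers function
does: 1/Γ(k - m) kills k ≤ m, and a numerator Pochhammer symbol kills k > m. -/
lemma poissonTerm_eq_zero {lam : ℂ} {m : ℕ} (hm : lam + 1 + m = 0) {θ θ' : ℝ}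
    (hθ : θ ∈ Set.Ioo 0 Real.pi) (t : ℂ) (n : ℕ) : poissonTerm lam θ θ' t n = 0 := by
  obtain rfl : lam = -(m + 1 : ℂ) := by linear_combination hm
  by_cases hn : 2 * m + 1 < n
  · have h : (ascPochhammer ℂ n).eval (2 * -(m + 1 : ℂ) + 1) = 0 := by
      rw [show 2 * -(m + 1 : ℂ) + 1 = -((2 * m + 1 : ℕ) : ℂ) by push_cast; ring]
      exact ascPochhammer_eval_neg_coe_nat_of_lt hn
    rw [poissonTerm, h]
    ring
  have hP : ferrersP (n + -(m + 1 : ℂ)) (-(-(m + 1 : ℂ))) (Real.cos θ) = 0 := by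
    have hs : 0 < Real.sin θ := Real.sin_pos_of_mem_Ioo hθ
    have hsc := Real.sin_sq_add_cos_sq θ
    have hz : ‖(((1 - Real.cos θ) / 2 : ℝ) : ℂ)‖ < 1 := by
      rw [norm_real, Real.norm_of_nonneg (by nlinarith)]
      nlinarith
    rw [ferrersP, regHyp, if_pos hz, regHypSeries]
    refine mul_eq_zero_of_right _ ((tsum_congr fun k => ?_).trans tsum_zero)
    by_cases hk : k ≤ m
    · have h : Gamma (1 - -(-(m + 1 : ℂ)) + k) = 0 := by
        rw [show 1 - -(-(m + 1 : ℂ)) + k = -((m - k : ℕ) : ℂ) by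
          rw [Nat.cast_sub hk]; ring]
        exact Gamma_neg_nat_eq_zero _
      rw [h, inv_zero]
      ring
    · by_cases hnm : n ≤ m
      · have h : (ascPochhammer ℂ k).eval (n + -(m + 1 : ℂ) + 1) = 0 := by
          rw [show (n : ℂ) + -(m + 1 : ℂ) + 1 = -((m - n : ℕ) : ℂ) by
            rw [Nat.cast_sub hnm]; ring]
          exact ascPochhammer_eval_neg_coe_nat_of_lt (by omega)
        rw [h]
        ring
      · have h : (ascPochhammer ℂ k).eval (-(n + -(m + 1 : ℂ))) = 0 := by
          rw [show -((n : ℂ) + -(m + 1 : ℂ)) = -((n - (m + 1) : ℕ) : ℂ) by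
            rw [Nat.cast_sub (by omega)]; push_cast; ring]
          exact ascPochhammer_eval_neg_coe_nat_of_lt (by omega)
        rw [h]
        ring
  rw [poissonTerm, hP]
  ring

lemma poissonClosedForm_eq_zero {lam : ℂ} {m : ℕ} (hm : lam + 1 + m = 0) (θ θ' : ℝ) (t : ℂ) :
    poissonClosedForm lam θ θ' t = 0 := by
  have h : Gamma (2 * lam + 1) = 0 := by
    rw [show 2 * lam + 1 = -((2 * m + 1 : ℕ) : ℂ) by push_cast; linear_combination 2 * hm]
    exact Gamma_neg_nat_eq_zero _
  rw [poissonClosedForm, h]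
  simp

theorem mainTheorem4 (lam : ℂ) (hlam : ∀ k : ℕ, lam + 1 / 2 ≠ -(k : ℂ))
    (θ θ' : ℝ) (hθ : θ ∈ Set.Ioo 0 Real.pi) (hθ' : θ' ∈ Set.Ioo 0 Real.pi)
    (t : ℂ) (ht : ‖t‖ < 1) :
    (t ∈ slitPlane →
      poissonChi θ θ' t - 1 ∈ slitPlane ∧
      HasSum (poissonTerm lam θ θ' t) (poissonClosedForm lam θ θ' t)) ∧
    (t ∉ slitPlane →
      Summable (poissonTerm lam θ θ' t) ∧
      Tendsto (poissonClosedForm lam θ θ') (𝓝[slitPlane] t)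
        (𝓝 (∑' n : ℕ, poissonTerm lam θ θ' t n))) := by
  have hs := Real.sin_pos_of_mem_Ioo hθ
  have hs' := Real.sin_pos_of_mem_Ioo hθ'
  by_cases hint : ∃ m : ℕ, lam + 1 + m = 0
  · obtain ⟨m, hm⟩ := hint
    have h0 : poissonTerm lam θ θ' t = fun _ => 0 := funext (poissonTerm_eq_zero hm hθ t)
    have h1 : poissonClosedForm lam θ θ' = fun _ => 0 :=
      funext (poissonClosedForm_eq_zero hm θ θ')
    rw [h0, h1]
    refine ⟨fun hts => ⟨poissonChi_sub_one_mem_slitPlane hs hs' ht hts, hasSum_zero⟩,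
      fun _ => ⟨summable_zero, ?_⟩⟩
    rw [tsum_zero]
    exact tendsto_const_nhds
  · push Not at hint
    -- Even k is excluded by the hypothesis on λ + 1/2, odd k by λ not being a negative integer.
    have h2 : ∀ k : ℕ, 2 * (lam + 1 / 2) + k ≠ 0 := by
      intro k hk
      obtain ⟨j, rfl | rfl⟩ := k.even_or_odd'
      · push_cast at hk
        exact hlam j (by linear_combination hk / 2)
      · push_cast at hk
        exact hint j (by linear_combination hk / 2)
    have hsum := hasSum_poissonTerm h2 hθ hθ' ht
    refine ⟨fun hts => ⟨poissonChi_sub_one_mem_slitPlane hs hs' ht hts, ?_⟩,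
      fun _ => ⟨hsum.summable, ?_⟩⟩
    · rw [poissonClosedForm_eq h2 hs hs' ht hts]
      exact hsum
    · rw [hsum.tsum_eq]
      have hball : Metric.ball (0 : ℂ) 1 ∈ 𝓝 t :=
        Metric.isOpen_ball.mem_nhds (mem_ball_zero_iff.2 ht)
      have hcont : ContinuousAt (continuedKernel (lam + 1 / 2) θ θ') t :=
        ((differentiableOn_continuedKernel h2 hs hs').differentiableAt hball).continuousAt
      refine ((hcont.tendsto.const_mul _).mono_left nhdsWithin_le_nhds).congr' ?_
      filter_upwards [self_mem_nhdsWithin, nhdsWithin_le_nhds hball] with z hz hz1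
      exact (poissonClosedForm_eq h2 hs hs' (mem_ball_zero_iff.1 hz1) hz).symm
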